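/- For $0\le\alpha\le1$ and $0\le\theta\le\pi/4$ let $|\psi_\theta\rangle=\cos\theta|00\rangle+\sin\theta|11\rangle$, $\rho_A^\theta=\mathrm{Tr}_B|\psi_\theta\rangle\langle\psi_\theta|$ and $$\rho_{\alpha,\theta}=\alpha|\psi_\theta\rangle\langle\psi_\theta|+(1-\alpha)\,\rho_A^\theta\otimes\tfrac{\mathbb 1}{2},$$ a two-qubit state of systems $A,B$. For $N\ge2$ take $N$ copies, on $A_1B_1,\dots,A_NB_N$, let $F_B=|0\cdots0\rangle\big(\langle0\cdots0|+\langle1\cdots1|\big)$ act on $B_1\cdots B_N$, and let $$\rho_{A_1\cdots A_N}=\frac{\mathrm{Tr}_B\big[(\mathbb 1_A\otimes F_B)\,\rho_{\alpha,\theta}^{\otimes N}\,(\mathbb 1_A\otimes F_B)^\dagger\big]}{\mathrm{Tr}\big[(\mathbb 1_A\otimes F_B)\,\rho_{\alpha,\theta}^{\otimes N}\,(\mathbb 1_A\otimes F_B)^\dagger\big]} .$$ An $N$-qubit state is genuinely multipartite entangled (GME) if it is not a convex mixture $\sum_b p_b\sum_j q^b_j\,|\phi^b_j\rangle\langle\phi^b_j|_b\otimes|\chi^b_j\rangle\langle\chi^b_j|_{\bar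 b}$ over bipartitions $(b,\bar b)$ of the parties into two nonempty groups. It admits a fully local hidden variable model for projective measurements if there are a probability measure $q$ on a space of hidden variables $\lambda$ and response functions $p^{(i)}_\lambda(a\mid M)$ (measurable in $\lambda$, and for each $\lambda$, $i$, $M$ a probability distribution in $a$) with $\mathrm{Tr}\big[\rho\,\bigotimes_i M^{(i)}_{a_i}\big]=\int\prod_i p^{(i)}_\lambda(a_i\mid M^{(i)})\,dq(\lambda)$ for all projective qubit measurements $M^{(1)},\dots,M^{(N)}$ and all outcomes $a_1,\dots,a_N$. For an $N$-qubit state $\rho$ put $n=2^{N-1}$ and $C(\rho)=2\max_{1\le i\le n}\big\{|z_i|-\sum_{j\ne i}\sqrt{c_jd_j}\big\}$, where $c_j$ and $d_j$ ($1\le j\le n$) are the $j$-th diagonal entries of $\rho$ counted from the top and from the bottom in the computational basis, and $z_i$ is the $i$-th anti-diagonal entry, $z_i=\rho_{i,\,2^N+1-i}$. Let $N\ge2$. (1) For all $0\le\alpha\le1$ and $0\le\theta\le\pi/4$, $\rho_{A_1\cdots A_N}$ is a well-defined state with $$C(\rho_{A_1\cdots A_N})=\frac{2\sin^N(2\theta)\Big(\alpha^N+\big[\tfrac{1+\alpha}2\big]^N+\big[\tfrac{1-\alpha}2\big]^N-1\Big)}{[1+\alpha\cos2\theta]^N+[1-\alpha\cos2\theta]^N};$$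 if this is positive, then $\rho_{A_1\cdots A_N}$ is GME; and if $\alpha>0$ and $\cos^2(2\theta)\ge\frac{2\alpha-1}{(2-\alpha)\alpha^3}$, then $\rho_{A_1\cdots A_N}$ admits a fully local hidden variable model for projective measurements. (2) Let $\alpha=1-1/N^2$. Then $\alpha^N+\big[\tfrac{1+\alpha}2\big]^N+\big[\tfrac{1-\alpha}2\big]^N>1$, there is $\theta\in(0,\pi/4]$ with $\cos^2(2\theta)=\frac{2\alpha-1}{(2-\alpha)\alpha^3}$, and for every such $\theta$ one has $C(\rho_{A_1\cdots A_N})>0$, the state $\rho_{A_1\cdots A_N}$ is GME, and it admits a fully local hidden variable model for all local projective measurements. In particular, for every $N\ge2$ there are GME $N$-qubit states with a fully local hidden variable model for projective measurements. -/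

import Mathlib

open scoped Kronecker ComplexOrder

noncomputable section

/-- Operators on `(ℂ²)^{⊗N}`, as matrices in the computational basis
`|x⟩ = |x₁,…,x_N⟩` indexed by the bit strings `x : Fin N → Fin 2`. -/
abbrev QubitOp (N : ℕ) := Matrix (Fin N → Fin 2) (Fin N → Fin 2) ℂ

/-- Density operators. -/
def IsDensity {d : Type*} [Fintype d] (ρ : Matrix d d ℂ) : Prop :=
  ρ.PosSemidef ∧ ρ.trace = 1

/-- `|φ⟩⟨φ|`. -/
def ketbra {d : Type*} (φ : d → ℂ) : Matrix d d ℂ := Matrix.vecMulVec φ (star φ)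

/-- Unit vectors. -/
def IsUnitVec {d : Type*} [Fintype d] (φ : d → ℂ) : Prop := ∑ x, ‖φ x‖ ^ 2 = 1

/-- Partial trace over the second tensor factor. -/
def traceB {a b : Type*} [Fintype b] (M : Matrix (a × b) (a × b) ℂ) : Matrix a a ℂ :=
  Matrix.of fun i j => ∑ k, M (i, k) (j, k)

/-! ### Genuine multipartite entanglement -/

/-- `A ⊗ B`, where `A` acts on the parties in `b` and `B` on the parties outside `b`. -/
def bipTensor {N : ℕ} (b : Finset (Fin N))
    (A : Matrix ({i // i ∈ b} → Fin 2) ({i // i ∈ b} → Fin 2) ℂ)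
    (B : Matrix ({i // i ∉ b} → Fin 2) ({i // i ∉ b} → Fin 2) ℂ) : QubitOp N :=
  Matrix.of fun x y =>
    A (fun i => x i) (fun i => y i) * B (fun i => x i) (fun i => y i)

/-- The bipartitions `(b, b̄)` of the `N` parties into two nonempty groups (each one is listed
twice, as `b` and as its complement, which does not affect convex mixtures). -/
def bipartitions (N : ℕ) : Finset (Finset (Fin N)) :=
  Finset.univ.filter fun b => b.Nonempty ∧ b ≠ Finset.univ

/-- Biseparable states: mixtures over the bipartitions `b` of mixtures of pure states that are
products across `b`. -/
def IsBiseparable {N : ℕ} (ρ : QubitOp N) : Prop :=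
  ∃ (p : Finset (Fin N) → ℝ) (m : Finset (Fin N) → ℕ)
    (q : (b : Finset (Fin N)) → Fin (m b) → ℝ)
    (φ : (b : Finset (Fin N)) → Fin (m b) → ({i // i ∈ b} → Fin 2) → ℂ)
    (χ : (b : Finset (Fin N)) → Fin (m b) → ({i // i ∉ b} → Fin 2) → ℂ),
    (∀ b ∈ bipartitions N, 0 ≤ p b) ∧ ∑ b ∈ bipartitions N, p b = 1 ∧
    (∀ b ∈ bipartitions N, (∀ j, 0 ≤ q b j) ∧ ∑ j, q b j = 1 ∧
      ∀ j, IsUnitVec (φ b j) ∧ IsUnitVec (χ b j)) ∧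
    ρ = ∑ b ∈ bipartitions N,
      (p b : ℂ) • ∑ j, (q b j : ℂ) • bipTensor b (ketbra (φ b j)) (ketbra (χ b j))

/-- Genuinely multipartite entangled states. -/
def IsGME {N : ℕ} (ρ : QubitOp N) : Prop := IsDensity ρ ∧ ¬ IsBiseparable ρ

/-- The bit strings whose first bit is `0`: the first half of the computational basis. The `j`-th
basis vector from the end is the bitwise complement `1 - x` of the `j`-th one `x`. -/
def firstHalf (N : ℕ) : Finset (Fin N → Fin 2) :=
  Finset.univ.filter fun x => ∀ i : Fin N, (i : ℕ) = 0 → x i = 0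

/-- `C(ρ) = 2 max_i (|z_i| - ∑_{j ≠ i} √(c_j d_j))`, where `c_j` and `d_j` are the `j`-th diagonal
entry of `ρ` from the start and from the end, and `z_i` is the `i`-th anti-diagonal entry. -/
def concurrence {N : ℕ} (ρ : QubitOp N) : ℝ :=
  2 * ⨆ x : {x // x ∈ firstHalf N},
    (‖ρ x.1 (1 - x.1)‖ -
      ∑ y ∈ (firstHalf N).erase x.1, √((ρ y y).re * (ρ (1 - y) (1 - y)).re))

/-! ### Local projective measurements and fully local models -/

/-- A projective measurement on a qubit with outcomes `0, …, k-1`: mutually orthogonal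
projections (possibly of rank 0 or 2) that sum to the identity. -/
structure ProjMeas (k : ℕ) where
  P : Fin k → Matrix (Fin 2) (Fin 2) ℂ
  herm : ∀ a, (P a).IsHermitian
  idem : ∀ a, P a * P a = P a
  orth : ∀ a b, a ≠ b → P a * P b = 0
  sum_eq_one : ∑ a, P a = 1

/-- `M₁ ⊗ ⋯ ⊗ M_N`. -/
def localTensor {N : ℕ} (M : Fin N → Matrix (Fin 2) (Fin 2) ℂ) : QubitOp N :=
  Matrix.of fun x y => ∏ i, M i (x i) (y i)

/-- `ρ` admits a fully local hidden variable model for all local projective measurements: one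
probability space of hidden variables `l`, and for each party `i` one response function
`r i k M a l = p_l(a | M)` depending only on the party's own measurement `M`, reproduce the
quantum statistics of all choices of local projective measurements. -/
def HasFullyLocalModel {N : ℕ} (ρ : QubitOp N) : Prop :=
  ∃ (Λ : Type) (_ : MeasurableSpace Λ) (μ : MeasureTheory.Measure Λ)
    (_ : MeasureTheory.IsProbabilityMeasure μ)
    (r : Fin N → (k : ℕ) → ProjMeas k → Fin k → Λ → ℝ),
    (∀ i k M a, Measurable (r i k M a)) ∧
    (∀ i k M a l, 0 ≤ r i k M a l) ∧
    (∀ i k M l, ∑ a, r i k M a l = 1) ∧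
    ∀ (k : Fin N → ℕ) (M : (i : Fin N) → ProjMeas (k i)) (a : (i : Fin N) → Fin (k i)),
      (ρ * localTensor fun i => (M i).P (a i)).trace =
        ((∫ l, ∏ i, r i (k i) (M i) (a i) l ∂μ : ℝ) : ℂ)

/-! ### The states -/

/-- `|ψ_θ⟩ = cos θ |00⟩ + sin θ |11⟩`. -/
def psi (θ : ℝ) : Fin 2 × Fin 2 → ℂ :=
  Pi.single (0, 0) (Real.cos θ : ℂ) + Pi.single (1, 1) (Real.sin θ : ℂ)

/-- `ρ_{α,θ} = α |ψ_θ⟩⟨ψ_θ| + (1 - α) ρ_A^θ ⊗ 𝟙/2`, with `ρ_A^θ = Tr_B |ψ_θ⟩⟨ψ_θ|`. -/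
def rhoTwo (α θ : ℝ) : Matrix (Fin 2 × Fin 2) (Fin 2 × Fin 2) ℂ :=
  (α : ℂ) • ketbra (psi θ) +
    ((1 - α : ℝ) : ℂ) •
      (traceB (ketbra (psi θ)) ⊗ₖ ((1 / 2 : ℂ) • (1 : Matrix (Fin 2) (Fin 2) ℂ)))

/-- `ρ^{⊗N}` on `(A₁ ⊗ ⋯ ⊗ A_N) ⊗ (B₁ ⊗ ⋯ ⊗ B_N)`. -/
def copies (N : ℕ) (ρ : Matrix (Fin 2 × Fin 2) (Fin 2 × Fin 2) ℂ) :
    Matrix ((Fin N → Fin 2) × (Fin N → Fin 2)) ((Fin N → Fin 2) × (Fin N → Fin 2)) ℂ :=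
  Matrix.of fun x y => ∏ i, ρ (x.1 i, x.2 i) (y.1 i, y.2 i)

/-- `F_B = |0⋯0⟩ (⟨0⋯0| + ⟨1⋯1|)`. -/
def ghzFilter (N : ℕ) : QubitOp N :=
  Matrix.vecMulVec (Pi.single 0 1) (Pi.single 0 1 + Pi.single 1 1)

/-- The unnormalized state `(𝟙_A ⊗ F_B) ρ_{α,θ}^{⊗N} (𝟙_A ⊗ F_B)†`. -/
def filtered (N : ℕ) (α θ : ℝ) :
    Matrix ((Fin N → Fin 2) × (Fin N → Fin 2)) ((Fin N → Fin 2) × (Fin N → Fin 2)) ℂ :=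
  ((1 : QubitOp N) ⊗ₖ ghzFilter N) * copies N (rhoTwo α θ) *
    ((1 : QubitOp N) ⊗ₖ ghzFilter N).conjTranspose

/-- The `N`-qubit state `ρ_{A₁⋯A_N}`. -/
def rhoA (N : ℕ) (α θ : ℝ) : QubitOp N :=
  (filtered N α θ).trace⁻¹ • traceB (filtered N α θ)

/-- The right-hand side `(2α - 1) / ((2 - α) α³)` of the unsteerability condition. -/
def steerBound (α : ℝ) : ℝ := (2 * α - 1) / ((2 - α) * α ^ 3)

end

/-!
The filter leaves only the blocks of `ρ_{α,θ}^{⊗N}` in which the bits of Bob's side are all `0` or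
all `1`. The filtered state is therefore proportional to `∑_{u,v} (⟨u|_B ρ_{α,θ} |v⟩_B)^{⊗N}`, a
diagonal matrix plus a single coherence between `|0⋯0⟩` and `|1⋯1⟩`, and `C` can be read off.

If a pure state `ψ` is a product across a bipartition, then exchanging the bits of `x` and of its
complement `x̄` inside one block gives a second complementary pair `y, ȳ` with
`ψ_x ψ_x̄ = ψ_y ψ_ȳ`. By convexity and Cauchy–Schwarz, an anti-diagonal entry of a biseparable state
is thus dominated by the terms `√(c_j d_j)` of the other pairs, so that `C ≤ 0`.

Under the condition on `cos² 2θ`, the state `ρ_{α,θ}` is unsteerable from `A` to `B`: after a local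
transformation of `B`, a hidden direction uniform on the Bloch sphere and cap-shaped responses
reproduce all assemblages, by Archimedes' hat-box theorem. So `Tr_A[(M_a ⊗ 1) ρ] = ∫ r_λ(a|M) τ_λ`
with `τ_λ ≥ 0`, and the filtered statistics are `∫ W(λ) ∏ᵢ r_{λᵢ}(aᵢ|Mᵢ)` with the weight
`W(λ) = ∑_{u,v} ∏ᵢ ⟨u|τ_{λᵢ}|v⟩`. By the Schur product theorem `W ≥ 0`: filtering merely reweights
the hidden variables.
-/

/-! ### Tensor products of operators and partial traces -/

open Matrix

section Tensor

variable {ι m d : Type*} {N : ℕ}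

theorem posSemidef_prod_submatrix [Finite m] {M : ι → Matrix d d ℂ}
    (hM : ∀ i, (M i).PosSemidef) (f : ι → m → d) (s : Finset ι) :
    (of fun x y => ∏ i ∈ s, M i (f i x) (f i y)).PosSemidef := by
  classical
  induction s using Finset.induction_on with
  | empty => simpa [vecMulVec] using posSemidef_vecMulVec_self_star (1 : m → ℂ)
  | insert i s hi ih =>
    have hschur : (of fun x y => ∏ j ∈ insert i s, M j (f j x) (f j y)) =
        (M i).submatrix (f i) (f i) ⊙ of fun x y => ∏ j ∈ s, M j (f j x) (f j y) := by
      ext x y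
      simp [hadamard_apply, Finset.prod_insert hi]
    exact hschur ▸ ((hM i).submatrix (f i)).hadamard ih

theorem posSemidef_copies {ρ : Matrix (Fin 2 × Fin 2) (Fin 2 × Fin 2) ℂ} (hρ : ρ.PosSemidef) :
    (copies N ρ).PosSemidef :=
  posSemidef_prod_submatrix (fun _ => hρ)
    (fun i (x : (Fin N → Fin 2) × (Fin N → Fin 2)) => (x.1 i, x.2 i)) Finset.univ

theorem localTensor_mul (M P : Fin N → Matrix (Fin 2) (Fin 2) ℂ) :
    localTensor M * localTensor P = localTensor fun i => M i * P i := by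
  ext x y
  simp only [localTensor, mul_apply, of_apply, ← Finset.prod_mul_distrib,
    Finset.prod_univ_sum, Fintype.piFinset_univ]

theorem trace_localTensor (M : Fin N → Matrix (Fin 2) (Fin 2) ℂ) :
    (localTensor M).trace = ∏ i, (M i).trace := by
  simp only [trace, diag_apply, localTensor, of_apply, Finset.prod_univ_sum,
    Fintype.piFinset_univ]

theorem localTensor_diagonal (d : Fin N → Fin 2 → ℂ) :
    (localTensor fun i => diagonal (d i)) = diagonal fun x => ∏ i, d i (x i) := by
  ext x y
  rcases eq_or_ne x y with rfl | hxy
  · simp [localTensor]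
  · obtain ⟨i, hi⟩ := Function.ne_iff.mp hxy
    rw [diagonal_apply_ne _ hxy]
    exact Finset.prod_eq_zero (Finset.mem_univ i) (diagonal_apply_ne _ hi)

theorem localTensor_single (a b : Fin 2) (c : ℂ) :
    (localTensor fun _ : Fin N => single a b c) = single (fun _ => a) (fun _ => b) (c ^ N) := by
  ext x y
  by_cases h : (fun _ => a) = x ∧ (fun _ => b) = y
  · obtain ⟨rfl, rfl⟩ := h
    simp [localTensor]
  · rw [single_apply_of_ne (h := h)]
    obtain ⟨i, hi⟩ : ∃ i, ¬(a = x i ∧ b = y i) := by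
      by_contra! hall
      exact h ⟨funext fun i => (hall i).1, funext fun i => (hall i).2⟩
    exact Finset.prod_eq_zero (Finset.mem_univ i) (single_apply_of_ne _ _ _ _ _ hi)

end Tensor

section Block

variable {a b : Type*}

/-- The block `⟨u|_B M |v⟩_B` of an operator `M` on `A ⊗ B`: `M = ∑ u v, bBlock M u v ⊗ |u⟩⟨v|`. -/
def bBlock (M : Matrix (a × b) (a × b) ℂ) (u v : b) : Matrix a a ℂ :=
  M.submatrix (·, u) (·, v)

theorem traceB_eq_sum_bBlock [Fintype b] (M : Matrix (a × b) (a × b) ℂ) :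
    traceB M = ∑ u, bBlock M u u := by
  ext x y
  simp [traceB, bBlock, Matrix.sum_apply]

theorem trace_traceB [Fintype a] [Fintype b] (M : Matrix (a × b) (a × b) ℂ) :
    (traceB M).trace = M.trace := by
  simp [trace, traceB, Fintype.sum_prod_type]

theorem posSemidef_traceB [Fintype b] {M : Matrix (a × b) (a × b) ℂ} (hM : M.PosSemidef) :
    (traceB M).PosSemidef := by
  rw [traceB_eq_sum_bBlock]
  exact posSemidef_sum _ fun u _ => hM.submatrix (·, u)

theorem traceB_conj_one_kronecker_vecMulVec_single [Fintype a] [DecidableEq a] [Fintype b]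
    [DecidableEq b] (M : Matrix (a × b) (a × b) ℂ) (k : b) (w : b → ℂ) :
    traceB (((1 : Matrix a a ℂ) ⊗ₖ vecMulVec (Pi.single k 1) w) * M *
      ((1 : Matrix a a ℂ) ⊗ₖ vecMulVec (Pi.single k 1) w)ᴴ) =
        ∑ u, ∑ v, (w u * star (w v)) • bBlock M u v := by
  ext x y
  simp only [traceB, bBlock, of_apply, mul_apply, conjTranspose_apply, kroneckerMap_apply,
    vecMulVec_apply, one_apply, Pi.single_apply, Matrix.sum_apply, Matrix.smul_apply,
    submatrix_apply, smul_eq_mul, Fintype.sum_prod_type, apply_ite star, star_zero, ite_mul,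
    mul_ite, one_mul, zero_mul, mul_zero, Finset.sum_mul, Finset.sum_ite_irrel,
    Finset.sum_const_zero, Finset.sum_ite_eq, Finset.sum_ite_eq', Finset.mem_univ, if_true]
  rw [Finset.sum_comm]
  refine Finset.sum_congr rfl fun u _ => Finset.sum_congr rfl fun v _ => ?_
  ring

end Block

/-! ### The filtered state -/

theorem traceB_filtered (N : ℕ) (α θ : ℝ) :
    traceB (filtered N α θ) =
      ∑ u : Fin 2, ∑ v : Fin 2, localTensor fun _ => bBlock (rhoTwo α θ) u v := by
  have hblock (u v : Fin 2) : bBlock (copies N (rhoTwo α θ)) (fun _ => u) (fun _ => v) =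
      localTensor fun _ => bBlock (rhoTwo α θ) u v := rfl
  rw [filtered, ghzFilter, traceB_conj_one_kronecker_vecMulVec_single]
  simp only [Fin.sum_univ_two, ← hblock]
  simp only [Pi.add_apply, Pi.single_apply, star_add, apply_ite star, star_one, star_zero,
    mul_add, mul_ite, mul_one, mul_zero, add_smul, ite_smul, one_smul, zero_smul,
    Finset.sum_add_distrib, Finset.sum_ite_eq', Finset.mem_univ, if_true]
  exact add_add_add_comm _ _ _ _

theorem posSemidef_ketbra {d : Type*} [Finite d] (φ : d → ℂ) : (ketbra φ).PosSemidef :=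
  posSemidef_vecMulVec_self_star φ

theorem posSemidef_rhoTwo {α : ℝ} (hα0 : 0 ≤ α) (hα1 : α ≤ 1) (θ : ℝ) :
    (rhoTwo α θ).PosSemidef := by
  have hmixed : ((1 / 2 : ℂ) • (1 : Matrix (Fin 2) (Fin 2) ℂ)).PosSemidef :=
    PosSemidef.one.smul one_half_pos.le
  exact ((posSemidef_ketbra _).smul (by exact_mod_cast hα0)).add
    (((posSemidef_traceB (posSemidef_ketbra _)).kronecker hmixed).smul
      (by exact_mod_cast sub_nonneg.2 hα1))

theorem bBlock_rhoTwo_zero_zero (α θ : ℝ) : bBlock (rhoTwo α θ) 0 0 =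
    diagonal fun s => ((![Real.cos θ ^ 2, Real.sin θ ^ 2] s *
      ![(1 + α) / 2, (1 - α) / 2] s : ℝ) : ℂ) := by
  ext s t
  fin_cases s <;> fin_cases t <;>
    simp [bBlock, rhoTwo, ketbra, psi, traceB, vecMulVec_apply, Pi.single_apply,
      -Complex.ofReal_cos, -Complex.ofReal_sin] <;> ring

theorem bBlock_rhoTwo_one_one (α θ : ℝ) : bBlock (rhoTwo α θ) 1 1 =
    diagonal fun s => ((![Real.cos θ ^ 2, Real.sin θ ^ 2] s *
      ![(1 - α) / 2, (1 + α) / 2] s : ℝ) : ℂ) := by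
  ext s t
  fin_cases s <;> fin_cases t <;>
    simp [bBlock, rhoTwo, ketbra, psi, traceB, vecMulVec_apply, Pi.single_apply,
      -Complex.ofReal_cos, -Complex.ofReal_sin] <;> ring

theorem bBlock_rhoTwo_of_ne {u v : Fin 2} (huv : u ≠ v) (α θ : ℝ) :
    bBlock (rhoTwo α θ) u v = single u v ((α * (Real.cos θ * Real.sin θ) : ℝ) : ℂ) := by
  obtain ⟨rfl, rfl⟩ | ⟨rfl, rfl⟩ : u = 0 ∧ v = 1 ∨ u = 1 ∧ v = 0 := by omega
  all_goals
    ext s t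
    fin_cases s <;> fin_cases t <;>
      simp [bBlock, rhoTwo, ketbra, psi, traceB, vecMulVec_apply, Pi.single_apply, mul_comm,
        -Complex.ofReal_cos, -Complex.ofReal_sin]

section GhzForm

variable {N : ℕ}

/-- The operators `∑ x, d x |x⟩⟨x| + g (|0⋯0⟩⟨1⋯1| + |1⋯1⟩⟨0⋯0|)`, whose only off-diagonal entries
are the extreme anti-diagonal ones. -/
def ghzForm (d : (Fin N → Fin 2) → ℝ) (g : ℝ) : QubitOp N :=
  diagonal (fun x => (d x : ℂ)) + single 0 1 (g : ℂ) + single 1 0 (g : ℂ)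

theorem smul_ghzForm (c : ℝ) (d : (Fin N → Fin 2) → ℝ) (g : ℝ) :
    (c : ℂ) • ghzForm d g = ghzForm (c • d) (c * g) := by
  ext x y
  simp [ghzForm, diagonal_apply, single_apply, mul_add]

/-- `flipWeight p q x = p ^ |x|₀ q ^ |x|₁ + q ^ |x|₀ p ^ |x|₁`, where `|x|ₛ` is the number of bits
of `x` equal to `s`: up to the marginal weights of party `A`, the diagonal of the filtered state. -/
def flipWeight (p q : ℝ) (x : Fin N → Fin 2) : ℝ :=
  ∏ i, ![p, q] (x i) + ∏ i, ![q, p] (x i)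

/-- The diagonal of the unnormalized filtered state. -/
noncomputable def diagWeight (α θ : ℝ) (x : Fin N → Fin 2) : ℝ :=
  (∏ i, ![Real.cos θ ^ 2, Real.sin θ ^ 2] (x i)) * flipWeight ((1 + α) / 2) ((1 - α) / 2) x

theorem traceB_filtered_eq_ghzForm (α θ : ℝ) : traceB (filtered N α θ) =
    ghzForm (diagWeight α θ) ((α * (Real.cos θ * Real.sin θ)) ^ N) := by
  have hdiag : (diagonal fun x : Fin N → Fin 2 => (diagWeight α θ x : ℂ)) =
      (localTensor fun _ => bBlock (rhoTwo α θ) 0 0) +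
        localTensor fun _ => bBlock (rhoTwo α θ) 1 1 := by
    simp only [bBlock_rhoTwo_zero_zero, bBlock_rhoTwo_one_one, localTensor_diagonal, diagonal_add,
      diagWeight, flipWeight, mul_add, ← Finset.prod_mul_distrib, Complex.ofReal_add,
      Complex.ofReal_prod]
  rw [traceB_filtered, ghzForm, hdiag]
  simp only [Fin.sum_univ_two, bBlock_rhoTwo_of_ne zero_ne_one, bBlock_rhoTwo_of_ne one_ne_zero,
    localTensor_single, Complex.ofReal_pow]
  change _ + single 0 1 _ + (single 1 0 _ + _) = _
  abel

end GhzForm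

/-- The probability that the filter succeeds, up to normalization of the filter: the trace of the
filtered operator. -/
noncomputable def successProb (N : ℕ) (α θ : ℝ) : ℝ :=
  ((1 + α * Real.cos (2 * θ)) / 2) ^ N + ((1 - α * Real.cos (2 * θ)) / 2) ^ N

theorem successProb_pos (N : ℕ) {α : ℝ} (hα0 : 0 ≤ α) (hα1 : α ≤ 1) (θ : ℝ) :
    0 < successProb N α θ := by
  obtain ⟨hlo, hhi⟩ := abs_le.1 ((abs_mul α (Real.cos (2 * θ))).trans_le
    (mul_le_one₀ (abs_le.2 ⟨by linarith, hα1⟩) (abs_nonneg _) (Real.abs_cos_le_one _)))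
  rcases hlo.eq_or_lt with h | h
  · exact add_pos_of_nonneg_of_pos (pow_nonneg (by linarith) _) (pow_pos (by linarith) _)
  · exact add_pos_of_pos_of_nonneg (pow_pos (by linarith) _) (pow_nonneg (by linarith) _)

theorem two_pow_mul_successProb (N : ℕ) (α θ : ℝ) :
    2 ^ N * successProb N α θ =
      (1 + α * Real.cos (2 * θ)) ^ N + (1 - α * Real.cos (2 * θ)) ^ N := by
  simp only [successProb, mul_add, ← mul_pow, mul_div_cancel₀ _ (two_ne_zero' ℝ)]

theorem trace_filtered (N : ℕ) [NeZero N] (α θ : ℝ) :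
    (filtered N α θ).trace = successProb N α θ := by
  have h00 : (bBlock (rhoTwo α θ) 0 0).trace = ((1 + α * Real.cos (2 * θ)) / 2 : ℝ) := by
    rw [bBlock_rhoTwo_zero_zero, trace_diagonal, ← Complex.ofReal_sum, Fin.sum_univ_two,
      Real.cos_two_mul]
    congr 1
    simp only [cons_val_zero, cons_val_one, Real.sin_sq]
    ring
  have h11 : (bBlock (rhoTwo α θ) 1 1).trace = ((1 - α * Real.cos (2 * θ)) / 2 : ℝ) := by
    rw [bBlock_rhoTwo_one_one, trace_diagonal, ← Complex.ofReal_sum, Fin.sum_univ_two,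
      Real.cos_two_mul]
    congr 1
    simp only [cons_val_zero, cons_val_one, Real.sin_sq]
    ring
  rw [← trace_traceB, traceB_filtered]
  simp only [Fin.sum_univ_two, trace_add, trace_localTensor, h00, h11,
    bBlock_rhoTwo_of_ne zero_ne_one, bBlock_rhoTwo_of_ne one_ne_zero,
    trace_single_eq_of_ne _ _ _ zero_ne_one, trace_single_eq_of_ne _ _ _ one_ne_zero,
    Finset.prod_const, Finset.card_univ, Fintype.card_fin, zero_pow (NeZero.ne N), add_zero,
    zero_add, ← Complex.ofReal_pow, ← Complex.ofReal_add, successProb]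

theorem rhoA_eq_ghzForm (N : ℕ) [NeZero N] (α θ : ℝ) :
    rhoA N α θ = ghzForm ((successProb N α θ)⁻¹ • diagWeight α θ)
      ((successProb N α θ)⁻¹ * (α * (Real.cos θ * Real.sin θ)) ^ N) := by
  rw [rhoA, trace_filtered, traceB_filtered_eq_ghzForm, ← Complex.ofReal_inv, smul_ghzForm]

theorem isDensity_rhoA (N : ℕ) [NeZero N] {α : ℝ} (hα0 : 0 ≤ α) (hα1 : α ≤ 1) (θ : ℝ) :
    IsDensity (rhoA N α θ) := by
  have hZ := successProb_pos N hα0 hα1 θ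
  rw [rhoA, trace_filtered, ← Complex.ofReal_inv]
  refine ⟨?_, ?_⟩
  · have hcopies := posSemidef_copies (N := N) (posSemidef_rhoTwo hα0 hα1 θ)
    exact (posSemidef_traceB (hcopies.mul_mul_conjTranspose_same _)).smul
      (by exact_mod_cast (inv_pos.2 hZ).le)
  · rw [trace_smul, trace_traceB, trace_filtered, smul_eq_mul, ← Complex.ofReal_mul,
      inv_mul_cancel₀ hZ.ne', Complex.ofReal_one]

/-! ### The concurrence of biseparable states -/

section FirstHalf

variable {N : ℕ}

theorem one_sub_one_sub (x : Fin N → Fin 2) : 1 - (1 - x) = x := sub_sub_cancel 1 x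

theorem mem_firstHalf [NeZero N] {x : Fin N → Fin 2} : x ∈ firstHalf N ↔ x 0 = 0 := by
  simp only [firstHalf, Finset.mem_filter, Finset.mem_univ, true_and, Fin.val_eq_zero_iff,
    forall_eq]

theorem one_sub_mem_firstHalf [NeZero N] {x : Fin N → Fin 2} :
    1 - x ∈ firstHalf N ↔ x ∉ firstHalf N := by
  simp only [mem_firstHalf, Pi.sub_apply, Pi.one_apply]
  omega

theorem sum_firstHalf_add_one_sub [NeZero N] (f : (Fin N → Fin 2) → ℝ) :
    ∑ x ∈ firstHalf N, (f x + f (1 - x)) = ∑ x, f x := by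
  have hflip : ∑ x ∈ firstHalf N, f (1 - x) = ∑ x ∈ (firstHalf N)ᶜ, f x :=
    Finset.sum_bij' (fun x _ => 1 - x) (fun x _ => 1 - x)
      (fun x hx => by simpa [one_sub_mem_firstHalf] using hx)
      (fun x hx => by simpa [one_sub_mem_firstHalf] using hx)
      (fun x _ => one_sub_one_sub x) (fun x _ => one_sub_one_sub x) (fun _ _ => rfl)
  rw [Finset.sum_add_distrib, hflip, Finset.sum_add_sum_compl]

end FirstHalf

section Biseparable

variable {N : ℕ}

/-- The inequality `|z_i| ≤ ∑_{j ≠ i} √(c_j d_j)` between the anti-diagonal and the diagonal of an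
operator with nonnegative diagonal; it says that `concurrence` is not positive. -/
def HasDominatedAntidiagonal (ρ : QubitOp N) : Prop :=
  (∀ y, 0 ≤ (ρ y y).re) ∧ ∀ x ∈ firstHalf N,
    ‖ρ x (1 - x)‖ ≤ ∑ y ∈ (firstHalf N).erase x, √((ρ y y).re * (ρ (1 - y) (1 - y)).re)

theorem HasDominatedAntidiagonal.smul {ρ : QubitOp N} (hρ : HasDominatedAntidiagonal ρ) {c : ℝ}
    (hc : 0 ≤ c) : HasDominatedAntidiagonal ((c : ℂ) • ρ) := by
  refine ⟨fun y => by simpa using mul_nonneg hc (hρ.1 y), fun x hx => ?_⟩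
  have hsqrt (y : Fin N → Fin 2) : √((((c : ℂ) • ρ) y y).re * (((c : ℂ) • ρ) (1 - y) (1 - y)).re) =
      c * √((ρ y y).re * (ρ (1 - y) (1 - y)).re) := by
    simp only [Matrix.smul_apply, smul_eq_mul, Complex.re_ofReal_mul]
    rw [mul_mul_mul_comm, Real.sqrt_mul (mul_self_nonneg c), Real.sqrt_mul_self hc]
  rw [Finset.sum_congr rfl fun y _ => hsqrt y, ← Finset.mul_sum, Matrix.smul_apply, norm_smul,
    Complex.norm_real, Real.norm_of_nonneg hc]
  exact mul_le_mul_of_nonneg_left (hρ.2 x hx) hc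

theorem HasDominatedAntidiagonal.sum {ι : Type*} {s : Finset ι} {ρ : ι → QubitOp N}
    (hρ : ∀ i ∈ s, HasDominatedAntidiagonal (ρ i)) :
    HasDominatedAntidiagonal (∑ i ∈ s, ρ i) := by
  have hre (y : Fin N → Fin 2) : ((∑ i ∈ s, ρ i) y y).re = ∑ i ∈ s, (ρ i y y).re := by
    rw [Matrix.sum_apply, Complex.re_sum]
  refine ⟨fun y => hre y ▸ Finset.sum_nonneg fun i hi => (hρ i hi).1 y, fun x hx => ?_⟩
  have hcauchySchwarz (y : Fin N → Fin 2) :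
      ∑ i ∈ s, √((ρ i y y).re * (ρ i (1 - y) (1 - y)).re) ≤
        √(((∑ i ∈ s, ρ i) y y).re * ((∑ i ∈ s, ρ i) (1 - y) (1 - y)).re) := by
    rw [hre, hre]
    refine Real.le_sqrt_of_sq_le (Finset.sum_sq_le_sum_mul_sum_of_sq_le_mul s
      (fun i hi => (hρ i hi).1 y) (fun i hi => (hρ i hi).1 (1 - y)) fun i hi => ?_)
    exact (Real.sq_sqrt (mul_nonneg ((hρ i hi).1 y) ((hρ i hi).1 (1 - y)))).le
  calc ‖(∑ i ∈ s, ρ i) x (1 - x)‖ ≤ ∑ i ∈ s, ‖ρ i x (1 - x)‖ := by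
        rw [Matrix.sum_apply]
        exact norm_sum_le _ _
    _ ≤ ∑ i ∈ s, ∑ y ∈ (firstHalf N).erase x, √((ρ i y y).re * (ρ i (1 - y) (1 - y)).re) :=
        Finset.sum_le_sum fun i hi => (hρ i hi).2 x hx
    _ = ∑ y ∈ (firstHalf N).erase x, ∑ i ∈ s, √((ρ i y y).re * (ρ i (1 - y) (1 - y)).re) :=
        Finset.sum_comm
    _ ≤ _ := Finset.sum_le_sum fun y _ => hcauchySchwarz y

theorem ketbra_diag_re {d : Type*} (ψ : d → ℂ) (x : d) : (ketbra ψ x x).re = ‖ψ x‖ ^ 2 := by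
  rw [ketbra, vecMulVec_apply, Pi.star_apply, RCLike.star_def, Complex.mul_conj']
  norm_cast

theorem norm_ketbra_apply {d : Type*} (ψ : d → ℂ) (x y : d) :
    ‖ketbra ψ x y‖ = ‖ψ x * ψ y‖ := by
  simp [ketbra, vecMulVec_apply]

theorem sqrt_ketbra_diag_mul_ketbra_diag {d : Type*} (ψ : d → ℂ) (x y : d) :
    √((ketbra ψ x x).re * (ketbra ψ y y).re) = ‖ψ x * ψ y‖ := by
  rw [ketbra_diag_re, ketbra_diag_re, ← mul_pow, ← norm_mul, Real.sqrt_sq (norm_nonneg _)]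

/-- The vector `φ ⊗ χ`, with `φ` on the parties in `b` and `χ` on the parties outside `b`. -/
def bipVec (b : Finset (Fin N)) (φ : ({i // i ∈ b} → Fin 2) → ℂ)
    (χ : ({i // i ∉ b} → Fin 2) → ℂ) (x : Fin N → Fin 2) : ℂ :=
  φ (fun i => x i) * χ (fun i => x i)

variable (b : Finset (Fin N)) (φ : ({i // i ∈ b} → Fin 2) → ℂ) (χ : ({i // i ∉ b} → Fin 2) → ℂ)

theorem bipTensor_ketbra : bipTensor b (ketbra φ) (ketbra χ) = ketbra (bipVec b φ χ) := by
  ext x y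
  simp only [bipTensor, ketbra, bipVec, of_apply, vecMulVec_apply, Pi.star_apply, star_mul']
  ring

theorem bipVec_mul_bipVec (x y : Fin N → Fin 2) :
    bipVec b φ χ x * bipVec b φ χ y =
      bipVec b φ χ (b.piecewise y x) * bipVec b φ χ (b.piecewise x y) := by
  have hin (u v : Fin N → Fin 2) : (fun i : {i // i ∈ b} => b.piecewise u v i) = fun i => u i.1 :=
    funext fun i => b.piecewise_eq_of_mem u v i.2
  have hout (u v : Fin N → Fin 2) : (fun i : {i // i ∉ b} => b.piecewise u v i) = fun i => v i.1 :=
    funext fun i => b.piecewise_eq_of_notMem u v i.2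
  simp only [bipVec, hin, hout]
  ring

variable {b}

/- Exchanging the bits of `x` and `1 - x` in `b` gives another pair of complementary bit strings. -/
theorem exists_bipVec_mul_bipVec_one_sub_eq (hb : b ∈ bipartitions N) (x : Fin N → Fin 2) :
    ∃ y ∈ firstHalf N, y ≠ x ∧
      bipVec b φ χ y * bipVec b φ χ (1 - y) = bipVec b φ χ x * bipVec b φ χ (1 - x) := by
  obtain ⟨⟨i, hi⟩, hne⟩ : b.Nonempty ∧ b ≠ Finset.univ := (Finset.mem_filter.1 hb).2
  obtain ⟨j, hj⟩ : ∃ j, j ∉ b := by simpa [Finset.eq_univ_iff_forall] using hne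
  have : NeZero N := NeZero.of_pos i.pos
  have hflip : 1 - b.piecewise (1 - x) x = b.piecewise x (1 - x) := by
    ext k
    by_cases hk : k ∈ b <;> simp [hk]
  by_cases hmem : b.piecewise (1 - x) x ∈ firstHalf N
  · refine ⟨_, hmem, fun h => ?_, by rw [hflip, bipVec_mul_bipVec b φ χ x]⟩
    have hxi := congrFun h i
    simp only [Finset.piecewise_eq_of_mem _ _ _ hi, Pi.sub_apply, Pi.one_apply] at hxi
    omega
  · refine ⟨_, one_sub_mem_firstHalf.2 hmem, fun h => ?_, ?_⟩
    · have hxj := congrFun (hflip.symm.trans h) j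
      simp only [Finset.piecewise_eq_of_notMem _ _ _ hj, Pi.sub_apply, Pi.one_apply] at hxj
      omega
    · rw [one_sub_one_sub, hflip, mul_comm, bipVec_mul_bipVec b φ χ x]

theorem hasDominatedAntidiagonal_ketbra_bipVec (hb : b ∈ bipartitions N) :
    HasDominatedAntidiagonal (ketbra (bipVec b φ χ)) := by
  refine ⟨fun y => ketbra_diag_re _ y ▸ sq_nonneg _, fun x _ => ?_⟩
  obtain ⟨y, hy, hyx, hval⟩ := exists_bipVec_mul_bipVec_one_sub_eq φ χ hb x
  rw [norm_ketbra_apply, ← hval,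
    Finset.sum_congr rfl fun y _ => sqrt_ketbra_diag_mul_ketbra_diag (bipVec b φ χ) y (1 - y)]
  exact Finset.single_le_sum (f := fun y => ‖bipVec b φ χ y * bipVec b φ χ (1 - y)‖)
    (fun _ _ => norm_nonneg _) (Finset.mem_erase.2 ⟨hyx, hy⟩)

theorem IsBiseparable.hasDominatedAntidiagonal {ρ : QubitOp N} (hρ : IsBiseparable ρ) :
    HasDominatedAntidiagonal ρ := by
  obtain ⟨p, m, q, φ, χ, hp, -, hq, rfl⟩ := hρ
  refine .sum fun b hb => .smul (.sum fun j _ => .smul ?_ ((hq b hb).1 j)) (hp b hb)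
  rw [bipTensor_ketbra]
  exact hasDominatedAntidiagonal_ketbra_bipVec _ _ hb

theorem HasDominatedAntidiagonal.concurrence_nonpos {ρ : QubitOp N}
    (hρ : HasDominatedAntidiagonal ρ) : concurrence ρ ≤ 0 :=
  mul_nonpos_of_nonneg_of_nonpos zero_le_two
    (Real.iSup_nonpos fun x => sub_nonpos.2 (hρ.2 x.1 x.2))

theorem IsDensity.isGME_of_concurrence_pos {ρ : QubitOp N} (hρ : IsDensity ρ)
    (hpos : 0 < concurrence ρ) : IsGME ρ :=
  ⟨hρ, fun hsep => hpos.not_ge hsep.hasDominatedAntidiagonal.concurrence_nonpos⟩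

end Biseparable

/-! ### The concurrence of the filtered state -/

section Concurrence

variable {N : ℕ}

theorem bits_zero_ne_one [NeZero N] : (0 : Fin N → Fin 2) ≠ 1 :=
  Function.ne_iff.2 ⟨0, zero_ne_one⟩

theorem ghzForm_apply_self [NeZero N] (d : (Fin N → Fin 2) → ℝ) (g : ℝ) (x : Fin N → Fin 2) :
    ghzForm d g x x = d x := by
  have h01 : ¬((0 : Fin N → Fin 2) = x ∧ 1 = x) := fun h =>
    bits_zero_ne_one (h.1.trans h.2.symm)
  have h10 : ¬((1 : Fin N → Fin 2) = x ∧ 0 = x) := fun h =>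
    bits_zero_ne_one (h.2.trans h.1.symm)
  simp [ghzForm, single_apply_of_ne _ _ _ _ _ h01, single_apply_of_ne _ _ _ _ _ h10]

theorem ghzForm_apply_one_sub [NeZero N] (d : (Fin N → Fin 2) → ℝ) (g : ℝ) {x : Fin N → Fin 2}
    (hx : x ∈ firstHalf N) : ghzForm d g x (1 - x) = if x = 0 then (g : ℂ) else 0 := by
  have hne : x ≠ 1 - x := fun h => one_sub_mem_firstHalf.1 (h ▸ hx) hx
  have h1 : (1 : Fin N → Fin 2) ≠ x := by
    rintro rfl
    exact one_ne_zero (mem_firstHalf.1 hx)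
  rcases eq_or_ne x 0 with rfl | hx0
  · simp [ghzForm, bits_zero_ne_one]
  · simp [ghzForm, hne, h1, hx0, hx0.symm]

/- The best term is the one of `x = 0`: it has the only nonzero anti-diagonal entry and leaves out
the largest square root. -/
theorem concurrence_ghzForm [NeZero N] {d : (Fin N → Fin 2) → ℝ} (g : ℝ)
    (hd : ∀ x, √(d x * d (1 - x)) ≤ √(d 0 * d 1)) :
    concurrence (ghzForm d g) =
      2 * (|g| + √(d 0 * d 1) - ∑ x ∈ firstHalf N, √(d x * d (1 - x))) := by
  have h0 : (0 : Fin N → Fin 2) ∈ firstHalf N := mem_firstHalf.2 rfl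
  have hterm (x : Fin N → Fin 2) (hx : x ∈ firstHalf N) :
      ‖ghzForm d g x (1 - x)‖ - ∑ y ∈ (firstHalf N).erase x,
        √((ghzForm d g y y).re * (ghzForm d g (1 - y) (1 - y)).re) =
      (if x = 0 then |g| else 0) + √(d x * d (1 - x)) -
        ∑ y ∈ firstHalf N, √(d y * d (1 - y)) := by
    simp only [ghzForm_apply_self, ghzForm_apply_one_sub d g hx, Complex.ofReal_re, apply_ite norm,
      Complex.norm_real, Real.norm_eq_abs, norm_zero, ← Finset.add_sum_erase _ _ hx]
    ring
  have : Nonempty {x // x ∈ firstHalf N} := ⟨⟨0, h0⟩⟩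
  rw [concurrence, iSup_congr fun x : {x // x ∈ firstHalf N} => hterm x.1 x.2]
  congr 1
  refine le_antisymm (ciSup_le fun x => sub_le_sub_right (add_le_add ?_ (hd x)) _) ?_
  · split_ifs
    exacts [le_rfl, abs_nonneg g]
  · refine le_ciSup_of_le (Set.finite_range _).bddAbove ⟨0, h0⟩ ?_
    simp

theorem flipWeight_one_sub (p q : ℝ) (x : Fin N → Fin 2) :
    flipWeight p q (1 - x) = flipWeight p q x := by
  have hflip (p q : ℝ) (s : Fin 2) : ![p, q] (1 - s) = ![q, p] s := by fin_cases s <;> rfl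
  simp only [flipWeight, Pi.sub_apply, Pi.one_apply, hflip]
  exact add_comm _ _

theorem flipWeight_zero (p q : ℝ) : flipWeight p q (0 : Fin N → Fin 2) = p ^ N + q ^ N := by
  simp [flipWeight]

theorem flipWeight_nonneg {p q : ℝ} (hp : 0 ≤ p) (hq : 0 ≤ q) (x : Fin N → Fin 2) :
    0 ≤ flipWeight p q x := by
  have hnonneg {p q : ℝ} (hp : 0 ≤ p) (hq : 0 ≤ q) (s : Fin 2) : 0 ≤ ![p, q] s := by
    fin_cases s <;> assumption
  exact add_nonneg (Finset.prod_nonneg fun i _ => hnonneg hp hq _)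
    (Finset.prod_nonneg fun i _ => hnonneg hq hp _)

theorem flipWeight_le {p q : ℝ} (hp : 0 ≤ p) (hq : 0 ≤ q) (x : Fin N → Fin 2) :
    flipWeight p q x ≤ p ^ N + q ^ N := by
  set m := (Finset.univ.filter fun i => x i = 0).card
  set n := (Finset.univ.filter fun i => x i ≠ 0).card
  have hN : m + n = N := by
    simpa using Finset.card_filter_add_card_filter_not (s := Finset.univ) fun i => x i = 0
  have hprod (p q : ℝ) : ∏ i, ![p, q] (x i) = p ^ m * q ^ n := by
    have hite (s : Fin 2) : ![p, q] s = if s = 0 then p else q := by fin_cases s <;> rfl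
    simp only [hite, Finset.prod_ite, Finset.prod_const, m, n]
  have hmonovary : 0 ≤ (p ^ m - q ^ m) * (p ^ n - q ^ n) := by
    rcases le_total p q with h | h
    · exact mul_nonneg_of_nonpos_of_nonpos (sub_nonpos.2 (pow_le_pow_left₀ hp h _))
        (sub_nonpos.2 (pow_le_pow_left₀ hp h _))
    · exact mul_nonneg (sub_nonneg.2 (pow_le_pow_left₀ hq h _))
        (sub_nonneg.2 (pow_le_pow_left₀ hq h _))
  rw [flipWeight, hprod, hprod, ← hN, pow_add, pow_add]
  linarith

theorem sum_firstHalf_flipWeight [NeZero N] (p q : ℝ) :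
    ∑ x ∈ firstHalf N, flipWeight p q x = (p + q) ^ N := by
  have hbits (p q : ℝ) : ∑ x : Fin N → Fin 2, ∏ i, ![p, q] (x i) = (p + q) ^ N := by
    rw [← Fintype.sum_pow, Fin.sum_univ_two]
    rfl
  have hall := sum_firstHalf_add_one_sub (N := N) (flipWeight p q)
  simp only [flipWeight_one_sub, ← two_mul, ← Finset.mul_sum] at hall
  simp only [flipWeight, Finset.sum_add_distrib, hbits, add_comm q p] at hall ⊢
  linarith

theorem sqrt_diagWeight_mul_diagWeight_one_sub {α : ℝ} (hα0 : 0 ≤ α) (hα1 : α ≤ 1) (θ : ℝ)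
    (x : Fin N → Fin 2) :
    √(diagWeight α θ x * diagWeight α θ (1 - x)) =
      |Real.cos θ * Real.sin θ| ^ N * flipWeight ((1 + α) / 2) ((1 - α) / 2) x := by
  have hbit (s : Fin 2) : ![Real.cos θ ^ 2, Real.sin θ ^ 2] s *
      ![Real.cos θ ^ 2, Real.sin θ ^ 2] (1 - s) = |Real.cos θ * Real.sin θ| ^ 2 := by
    fin_cases s <;> simp [mul_pow, mul_comm]
  have hmarginal : (∏ i, ![Real.cos θ ^ 2, Real.sin θ ^ 2] (x i)) *
      ∏ i, ![Real.cos θ ^ 2, Real.sin θ ^ 2] ((1 - x) i) =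
        (|Real.cos θ * Real.sin θ| ^ N) ^ 2 := by
    simp only [← Finset.prod_mul_distrib, Pi.sub_apply, Pi.one_apply, hbit, Finset.prod_const,
      Finset.card_univ, Fintype.card_fin]
    rw [pow_right_comm]
  rw [diagWeight, diagWeight, flipWeight_one_sub, mul_mul_mul_comm, hmarginal, ← sq, ← mul_pow,
    Real.sqrt_sq (mul_nonneg (by positivity)
      (flipWeight_nonneg (by linarith) (by linarith) x))]

theorem concurrence_rhoA [NeZero N] {α θ : ℝ} (hα0 : 0 ≤ α) (hα1 : α ≤ 1)
    (hθ : 0 ≤ Real.sin (2 * θ)) :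
    concurrence (rhoA N α θ) =
      2 * Real.sin (2 * θ) ^ N * (α ^ N + ((1 + α) / 2) ^ N + ((1 - α) / 2) ^ N - 1) /
        ((1 + α * Real.cos (2 * θ)) ^ N + (1 - α * Real.cos (2 * θ)) ^ N) := by
  set Z := successProb N α θ with hZdef
  have hZ : 0 < Z := successProb_pos N hα0 hα1 θ
  have hcs : Real.cos θ * Real.sin θ = Real.sin (2 * θ) / 2 := by rw [Real.sin_two_mul]; ring
  have hcs0 : 0 ≤ Real.cos θ * Real.sin θ := hcs ▸ div_nonneg hθ zero_le_two
  set g := (Real.cos θ * Real.sin θ) ^ N with hg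
  have hsqrt (x : Fin N → Fin 2) :
      √((Z⁻¹ • diagWeight α θ) x * (Z⁻¹ • diagWeight α θ) (1 - x)) =
        Z⁻¹ * (g * flipWeight ((1 + α) / 2) ((1 - α) / 2) x) := by
    rw [Pi.smul_apply, Pi.smul_apply, smul_mul_smul_comm, smul_eq_mul,
      Real.sqrt_mul (mul_self_nonneg _), Real.sqrt_mul_self (inv_pos.2 hZ).le,
      sqrt_diagWeight_mul_diagWeight_one_sub hα0 hα1, abs_of_nonneg hcs0]
  have hsqrt0 := hsqrt 0
  rw [sub_zero, flipWeight_zero] at hsqrt0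
  have hg2 : Real.sin (2 * θ) ^ N = 2 ^ N * g := by rw [hg, hcs, ← mul_pow]; congr 1; ring
  rw [rhoA_eq_ghzForm, ← hZdef, concurrence_ghzForm]
  · have hnorm : (1 + α) / 2 + (1 - α) / 2 = 1 := by ring
    rw [Finset.sum_congr rfl fun x _ => hsqrt x, hsqrt0, ← Finset.mul_sum, ← Finset.mul_sum,
      sum_firstHalf_flipWeight, hnorm, one_pow, mul_pow, abs_of_nonneg (by positivity), hg2,
      ← two_pow_mul_successProb, ← hZdef]
    field_simp
    ring
  · intro x
    rw [hsqrt0, hsqrt]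
    gcongr
    exact flipWeight_le (by linarith) (by linarith) x

end Concurrence

/-! ### Uniformly distributed directions -/

section Sphere

open MeasureTheory Metric
open scoped ENNReal RealInnerProductSpace

theorem toSphere_preimage_coe {E : Type*} [NormedAddCommGroup E] [NormedSpace ℝ E]
    [MeasurableSpace E] [BorelSpace E] (μ : Measure E) {C : Set E} (hC : MeasurableSet C)
    (hC0 : 0 ∉ C) (hcone : ∀ r : ℝ, 0 < r → ∀ x ∈ C, r • x ∈ C) :
    μ.toSphere ((↑) ⁻¹' C) = Module.finrank ℝ E * μ (ball 0 1 ∩ C) := by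
  rw [μ.toSphere_apply' (hC.preimage measurable_subtype_coe), Subtype.image_preimage_coe]
  congr 2
  ext x
  rw [Set.mem_smul]
  constructor
  · rintro ⟨r, hr, n, ⟨hn, hnC⟩, rfl⟩
    refine ⟨?_, hcone r hr.1 n hnC⟩
    rw [mem_ball_zero_iff, norm_smul, mem_sphere_zero_iff_norm.mp hn, Real.norm_eq_abs,
      abs_of_pos hr.1, mul_one]
    exact hr.2
  · rintro ⟨hx1, hxC⟩
    have hx : x ≠ 0 := fun h => hC0 (h ▸ hxC)
    have hpos : 0 < ‖x‖ := norm_pos_iff.mpr hx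
    refine ⟨‖x‖, ⟨hpos, mem_ball_zero_iff.mp hx1⟩, ‖x‖⁻¹ • x,
      ⟨?_, hcone _ (inv_pos.mpr hpos) x hxC⟩, smul_inv_smul₀ hpos.ne' x⟩
    rw [mem_sphere_zero_iff_norm, norm_smul, norm_inv, norm_norm, inv_mul_cancel₀ hpos.ne']

variable {E : Type*} [NormedAddCommGroup E] [InnerProductSpace ℝ E] [MeasurableSpace E]
  [BorelSpace E] [FiniteDimensional ℝ E]

theorem measurePreserving_map_coe_toSphere (L : E ≃ₗᵢ[ℝ] E) :
    MeasurePreserving L ((volume : Measure E).toSphere.map (↑))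
      ((volume : Measure E).toSphere.map (↑)) := by
  have hL : Measurable L := L.continuous.measurable
  have hsector {s : Set E} (hs : MeasurableSet s) :
      (volume : Measure E).toSphere.map (↑) s =
        Module.finrank ℝ E * volume (ball 0 1 ∩ {x : E | x ≠ 0 ∧ ‖x‖⁻¹ • x ∈ s}) := by
    rw [Measure.map_apply measurable_subtype_coe hs, ← toSphere_preimage_coe]
    · congr 1
      ext n
      have hn : ‖(n : E)‖ = 1 := mem_sphere_zero_iff_norm.mp n.2
      have hn0 : (n : E) ≠ 0 := norm_ne_zero_iff.mp (by rw [hn]; exact one_ne_zero)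
      simp [hn0]
    · exact (measurableSet_singleton _).compl.inter (hs.preimage (by fun_prop))
    · simp
    · rintro r hr x ⟨hx, hxs⟩
      refine ⟨smul_ne_zero hr.ne' hx, ?_⟩
      rwa [norm_smul, Real.norm_eq_abs, abs_of_pos hr, smul_smul, mul_inv, mul_right_comm,
        inv_mul_cancel₀ hr.ne', one_mul]
  refine ⟨hL, Measure.ext fun s hs => ?_⟩
  rw [Measure.map_apply hL hs, hsector hs, hsector (hL hs),
    ← L.measurePreserving.measure_preimage_equiv (f := L.toMeasurableEquiv)
      (ball 0 1 ∩ {x | x ≠ 0 ∧ ‖x‖⁻¹ • x ∈ s})]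
  congr 2
  ext x
  simp

/-- The uniform distribution on the unit sphere. -/
noncomputable def uniformSphere (E : Type*) [NormedAddCommGroup E] [InnerProductSpace ℝ E]
    [MeasurableSpace E] [BorelSpace E] [FiniteDimensional ℝ E] : Measure (sphere (0 : E) 1) :=
  ((volume : Measure E).toSphere Set.univ)⁻¹ • (volume : Measure E).toSphere

instance isProbabilityMeasure_uniformSphere [Nontrivial E] :
    IsProbabilityMeasure (uniformSphere E) :=
  have : NeZero (volume : Measure E).toSphere := ⟨Measure.toSphere_ne_zero _⟩
  isProbabilityMeasureSMul

theorem integral_uniformSphere_comp_linearIsometryEquiv {F : Type*} [NormedAddCommGroup F]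
    [NormedSpace ℝ F] (L : E ≃ₗᵢ[ℝ] E) (f : E → F) :
    ∫ n, f (L n) ∂uniformSphere E = ∫ n, f n ∂uniformSphere E := by
  have hcoe : MeasurableEmbedding ((↑) : sphere (0 : E) 1 → E) :=
    .subtype_coe isClosed_sphere.measurableSet
  rw [uniformSphere, integral_smul_measure, integral_smul_measure,
    ← hcoe.integral_map fun x => f (L x), ← hcoe.integral_map f,
    (measurePreserving_map_coe_toSphere L).integral_comp
      L.toMeasurableEquiv.measurableEmbedding f]

theorem integral_coe_uniformSphere : ∫ n, (n : E) ∂uniformSphere E = 0 := by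
  have hneg := integral_uniformSphere_comp_linearIsometryEquiv (LinearIsometryEquiv.neg ℝ)
    (id : E → E)
  simp only [LinearIsometryEquiv.coe_neg, id, integral_neg] at hneg
  have : IsAddTorsionFree E := .of_isTorsionFree ℝ E
  exact self_eq_neg.mp hneg.symm

theorem integrable_smul_coe_sphere {μ : Measure (sphere (0 : E) 1)} {f : sphere (0 : E) 1 → ℝ}
    (hf : Integrable f μ) : Integrable (fun n => f n • (n : E)) μ :=
  hf.smul_bdd 1 continuous_subtype_val.aestronglyMeasurable
    (.of_forall fun n => (mem_sphere_zero_iff_norm.mp n.2).le)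

end Sphere

section Archimedes

open MeasureTheory Metric
open scoped ENNReal RealInnerProductSpace

theorem measure_ext_of_Ioi_of_measurePreserving_neg {μ ν : Measure ℝ} [IsFiniteMeasure μ]
    (hμ : MeasurePreserving Neg.neg μ μ) (hν : MeasurePreserving Neg.neg ν ν)
    (huniv : μ Set.univ = ν Set.univ) (h : ∀ a, 0 ≤ a → μ (Set.Ioi a) = ν (Set.Ioi a)) :
    μ = ν := by
  have : IsFiniteMeasure ν := ⟨huniv ▸ measure_lt_top μ _⟩
  have hpos : μ.restrict (Set.Ioi 0) = ν.restrict (Set.Ioi 0) := by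
    refine Measure.ext_of_Iic _ _ fun a => ?_
    rw [Measure.restrict_apply measurableSet_Iic, Measure.restrict_apply measurableSet_Iic,
      Set.inter_comm, Set.Ioi_inter_Iic]
    rcases le_or_gt 0 a with ha | ha
    · rw [← Set.Ioi_sdiff_Ioi, measure_sdiff (Set.Ioi_subset_Ioi ha) nullMeasurableSet_Ioi
        (measure_ne_top _ _), measure_sdiff (Set.Ioi_subset_Ioi ha) nullMeasurableSet_Ioi
        (measure_ne_top _ _), h 0 le_rfl, h a ha]
    · rw [Set.Ioc_eq_empty ha.not_gt, measure_empty, measure_empty]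
  refine Measure.ext_of_Ici _ _ fun a => ?_
  rcases lt_or_ge 0 a with ha | ha
  · have := congr($hpos (Set.Ici a))
    rwa [Measure.restrict_apply measurableSet_Ici, Measure.restrict_apply measurableSet_Ici,
      Set.inter_eq_left.mpr (Set.Ici_subset_Ioi.mpr ha)] at this
  · have hIio : μ (Set.Iio a) = ν (Set.Iio a) := by
      have hpre : Neg.neg ⁻¹' Set.Ioi (-a) = Set.Iio a := by simp
      rw [← hpre, hμ.measure_preimage nullMeasurableSet_Ioi,
        hν.measure_preimage nullMeasurableSet_Ioi, h _ (neg_nonneg.mpr ha)]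
    rw [← Set.compl_Iio, measure_compl measurableSet_Iio (measure_ne_top _ _),
      measure_compl measurableSet_Iio (measure_ne_top _ _), huniv, hIio]

theorem volume_setOf_norm_sq_snd_lt {f : ℝ → ℝ} (hf : Measurable f) :
    volume {p : ℝ × ℂ | ‖p.2‖ ^ 2 < f p.1} = ∫⁻ z, ENNReal.ofReal (Real.pi * f z) := by
  have hdisc (r : ℝ) : volume {w : ℂ | ‖w‖ ^ 2 < r} = ENNReal.ofReal (Real.pi * r) := by
    have hball : {w : ℂ | ‖w‖ ^ 2 < r} = ball 0 (√r) := by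
      ext w
      simp [Real.lt_sqrt (norm_nonneg w)]
    rw [hball, Complex.volume_ball, ← ENNReal.ofReal_pow (Real.sqrt_nonneg _), mul_comm,
      ← NNReal.coe_real_pi, ENNReal.ofReal_mul NNReal.pi.coe_nonneg, ENNReal.ofReal_coe_nnreal]
    rcases le_total 0 r with hr | hr
    · rw [Real.sq_sqrt hr]
    · rw [Real.sqrt_eq_zero_of_nonpos hr, ENNReal.ofReal_of_nonpos hr]
      simp
  have hmeas : MeasurableSet {p : ℝ × ℂ | ‖p.2‖ ^ 2 < f p.1} :=
    measurableSet_lt (by fun_prop) (by fun_prop)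
  rw [Measure.volume_eq_prod, Measure.prod_apply hmeas]
  exact lintegral_congr fun z => hdisc (f z)

/-- The squared radius at height `z` of the solid sector that joins the origin to the cap
`{h < z}` of the unit sphere: a cone below the height `h`, a spherical segment above it. -/
noncomputable def sectorProfile (h z : ℝ) : ℝ :=
  (Set.Ioc 0 h).indicator (fun z => z ^ 2 * (1 / h ^ 2 - 1)) z +
    (Set.Ioc h 1).indicator (fun z => 1 - z ^ 2) z

theorem lt_sectorProfile_iff {h z s : ℝ} (h0 : 0 ≤ h) (hs : 0 ≤ s) :
    s < sectorProfile h z ↔ z ^ 2 + s < 1 ∧ 0 < z ∧ h ^ 2 * (z ^ 2 + s) < z ^ 2 := by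
  rw [sectorProfile]
  rcases le_or_gt z 0 with hz | hz
  · simp [hz.not_gt, (hz.trans h0).not_gt, hs.not_gt]
  rcases le_or_gt z h with hzh | hzh
  · have hh : 0 < h ^ 2 := pow_pos (hz.trans_le hzh) 2
    have e : z ^ 2 * (1 / h ^ 2 - 1) = (z ^ 2 - h ^ 2 * z ^ 2) / h ^ 2 := by
      rw [sub_div, mul_div_cancel_left₀ _ hh.ne']
      ring
    have hz2 : z ^ 2 ≤ h ^ 2 := pow_le_pow_left₀ hz.le hzh 2
    rw [Set.indicator_of_mem (Set.mem_Ioc.mpr ⟨hz, hzh⟩),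
      Set.indicator_of_notMem fun hmem => hmem.1.not_ge hzh, add_zero, e, lt_div_iff₀ hh]
    exact ⟨fun hlt => ⟨by nlinarith, hz, by linarith⟩, fun hlt => by linarith [hlt.2.2]⟩
  · have hz2 : h ^ 2 < z ^ 2 := pow_lt_pow_left₀ hzh h0 two_ne_zero
    rw [Set.indicator_of_notMem fun hmem => hmem.2.not_gt hzh, zero_add]
    rcases le_or_gt z 1 with hz1 | hz1
    · rw [Set.indicator_of_mem (Set.mem_Ioc.mpr ⟨hzh, hz1⟩)]
      exact ⟨fun hlt => ⟨by linarith, hz, by nlinarith⟩, fun hlt => by linarith [hlt.1]⟩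
    · rw [Set.indicator_of_notMem fun hmem => hmem.2.not_gt hz1]
      exact ⟨fun hlt => absurd hlt hs.not_gt, fun hlt => by nlinarith [hlt.1]⟩

theorem sectorProfile_nonneg {h : ℝ} (h0 : 0 ≤ h) (h1 : h ≤ 1) (z : ℝ) : 0 ≤ sectorProfile h z := by
  refine add_nonneg (Set.indicator_nonneg (fun z hz => ?_) z)
    (Set.indicator_nonneg (fun z hz => ?_) z)
  · have hh : 0 < h ^ 2 := pow_pos (hz.1.trans_le hz.2) 2
    exact mul_nonneg (sq_nonneg z)
      (sub_nonneg.mpr ((one_le_div hh).mpr (pow_le_one₀ h0 h1)))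
  · exact sub_nonneg.mpr (pow_le_one₀ (h0.trans hz.1.le) hz.2)

theorem integrable_sectorProfile (h : ℝ) : Integrable (sectorProfile h) :=
  ((Continuous.integrableOn_Ioc (by fun_prop)).integrable_indicator measurableSet_Ioc).add
    ((Continuous.integrableOn_Ioc (by fun_prop)).integrable_indicator measurableSet_Ioc)

theorem integral_sectorProfile {h : ℝ} (h0 : 0 ≤ h) (h1 : h ≤ 1) :
    ∫ z, sectorProfile h z = 2 / 3 * (1 - h) := by
  simp only [sectorProfile]
  rw [integral_add ((Continuous.integrableOn_Ioc (by fun_prop)).integrable_indicator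
      measurableSet_Ioc) ((Continuous.integrableOn_Ioc (by fun_prop)).integrable_indicator
      measurableSet_Ioc),
    integral_indicator measurableSet_Ioc, integral_indicator measurableSet_Ioc,
    ← intervalIntegral.integral_of_le h0, ← intervalIntegral.integral_of_le h1,
    intervalIntegral.integral_mul_const, intervalIntegral.integral_sub (by simp) (by simp)]
  simp only [integral_pow, intervalIntegral.integral_const, smul_eq_mul]
  rcases h0.eq_or_lt with rfl | hpos
  · norm_num
  · field_simp
    ring

/-- Three-dimensional Euclidean space, the space of Bloch vectors `(z, x + i y)`. -/
abbrev Bloch := WithLp 2 (ℝ × ℂ)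

theorem Bloch.norm_sq_eq (x : Bloch) : ‖x‖ ^ 2 = x.fst ^ 2 + ‖x.snd‖ ^ 2 := by
  rw [WithLp.prod_norm_sq_eq_of_L2, Real.norm_eq_abs, sq_abs]

theorem finrank_bloch : Module.finrank ℝ Bloch = 3 := by
  rw [(WithLp.linearEquiv 2 ℝ (ℝ × ℂ)).finrank_eq]
  simp

theorem toSphere_univ_bloch :
    (volume : Measure Bloch).toSphere Set.univ = ENNReal.ofReal (4 * Real.pi) := by
  rw [Measure.toSphere_apply_univ, InnerProductSpace.volume_ball_of_dim_odd (k := 1) finrank_bloch,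
    finrank_bloch, ENNReal.ofReal_one, one_pow, one_mul, ← ENNReal.ofReal_natCast,
    ← ENNReal.ofReal_mul (by positivity)]
  congr 1
  simp only [Nat.doubleFactorial]
  push_cast
  ring

theorem ball_inter_setOf_mul_norm_lt_fst {h : ℝ} (h0 : 0 ≤ h) :
    ball (0 : Bloch) 1 ∩ {x | h * ‖x‖ < x.fst} =
      WithLp.ofLp ⁻¹' {p : ℝ × ℂ | ‖p.2‖ ^ 2 < sectorProfile h p.1} := by
  ext x
  have hx := norm_nonneg x
  have hmul : h * ‖x‖ < x.fst ↔ 0 < x.fst ∧ (h * ‖x‖) ^ 2 < x.fst ^ 2 := by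
    have hpos : 0 ≤ h * ‖x‖ := mul_nonneg h0 hx
    exact ⟨fun hlt => ⟨hpos.trans_lt hlt, pow_lt_pow_left₀ hlt hpos two_ne_zero⟩,
      fun hlt => lt_of_pow_lt_pow_left₀ 2 hlt.1.le hlt.2⟩
  simp only [Set.mem_inter_iff, mem_ball_zero_iff, Set.mem_ofPred_eq, Set.mem_preimage,
    WithLp.ofLp_fst, WithLp.ofLp_snd, lt_sectorProfile_iff h0 (sq_nonneg ‖x.snd‖),
    ← Bloch.norm_sq_eq, sq_lt_one_iff₀ hx, ← mul_pow, hmul]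

theorem toSphere_cap_bloch {h : ℝ} (h0 : 0 ≤ h) (h1 : h ≤ 1) :
    (volume : Measure Bloch).toSphere {n | h < (n : Bloch).fst} =
      ENNReal.ofReal (2 * Real.pi * (1 - h)) := by
  have hcap : {n : sphere (0 : Bloch) 1 | h < (n : Bloch).fst} =
      (↑) ⁻¹' {x : Bloch | h * ‖x‖ < x.fst} := by
    ext n
    simp
  have hprofile : Measurable (sectorProfile h) :=
    (Measurable.indicator (by fun_prop) measurableSet_Ioc).add
      (Measurable.indicator (by fun_prop) measurableSet_Ioc)
  rw [hcap, toSphere_preimage_coe, ball_inter_setOf_mul_norm_lt_fst h0,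
    (WithLp.volume_preserving_ofLp ℝ ℂ).measure_preimage,
    volume_setOf_norm_sq_snd_lt, ← ofReal_integral_eq_lintegral_ofReal, integral_const_mul,
    integral_sectorProfile h0 h1, finrank_bloch, ← ENNReal.ofReal_natCast,
    ← ENNReal.ofReal_mul (by positivity)]
  · congr 1
    push_cast
    ring
  · exact (integrable_sectorProfile h).const_mul _
  · exact .of_forall fun z => mul_nonneg Real.pi_pos.le (sectorProfile_nonneg h0 h1 z)
  · exact hprofile
  · exact (measurableSet_lt (by fun_prop) (by fun_prop)).nullMeasurableSet
  · exact measurableSet_lt (by fun_prop) (by fun_prop)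
  · simp
  · intro r hr x hx
    simp only [Set.mem_ofPred_eq, norm_smul, Real.norm_eq_abs, abs_of_pos hr, WithLp.smul_fst,
      smul_eq_mul, mul_left_comm h r] at hx ⊢
    exact mul_lt_mul_of_pos_left hx hr

theorem uniformSphere_cap {h : ℝ} (h0 : 0 ≤ h) :
    uniformSphere Bloch {n | h < (n : Bloch).fst} = ENNReal.ofReal ((1 - h) / 2) := by
  rcases le_or_gt h 1 with h1 | h1
  · rw [uniformSphere, Measure.smul_apply, toSphere_cap_bloch h0 h1, toSphere_univ_bloch,
      smul_eq_mul, ← ENNReal.ofReal_inv_of_pos (by positivity),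
      ← ENNReal.ofReal_mul (by positivity)]
    congr 1
    field_simp
    norm_num
  · have hempty : {n : sphere (0 : Bloch) 1 | h < (n : Bloch).fst} = ∅ := by
      refine Set.eq_empty_of_forall_notMem fun n (hn : h < (n : Bloch).fst) => ?_
      have hnorm := Bloch.norm_sq_eq n
      rw [mem_sphere_zero_iff_norm.mp n.2] at hnorm
      nlinarith [sq_nonneg ‖(n : Bloch).snd‖]
    rw [hempty, measure_empty, ENNReal.ofReal_of_nonpos (by linarith)]

theorem measurable_fst_coe_sphere : Measurable fun n : sphere (0 : Bloch) 1 => (n : Bloch).fst :=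
  have hfst : Measurable fun x : Bloch => x.fst := by fun_prop
  hfst.comp measurable_subtype_coe

theorem map_neg_map_fst_uniformSphere :
    ((uniformSphere Bloch).map fun n : sphere (0 : Bloch) 1 => (n : Bloch).fst).map Neg.neg =
      (uniformSphere Bloch).map fun n : sphere (0 : Bloch) 1 => (n : Bloch).fst := by
  have hfst : Measurable fun x : Bloch => x.fst := by fun_prop
  have hneg := congr(Measure.map (fun x : Bloch => x.fst)
    $((measurePreserving_map_coe_toSphere (LinearIsometryEquiv.neg ℝ (E := Bloch))).map_eq))
  rw [Measure.map_map hfst (LinearIsometryEquiv.continuous _).measurable,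
    Measure.map_map (by fun_prop) measurable_subtype_coe,
    Measure.map_map hfst measurable_subtype_coe] at hneg
  rw [uniformSphere, Measure.map_smul, Measure.map_smul,
    Measure.map_map measurable_neg measurable_fst_coe_sphere]
  exact congrArg _ hneg

/-- Archimedes' hat-box theorem. -/
theorem map_fst_uniformSphere :
    (uniformSphere Bloch).map (fun n : sphere (0 : Bloch) 1 => (n : Bloch).fst) =
      (2⁻¹ : ℝ≥0∞) • volume.restrict (Set.Icc (-1) 1) := by
  have := Measure.isProbabilityMeasure_map (μ := uniformSphere Bloch)
    measurable_fst_coe_sphere.aemeasurable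
  have hrestrict : MeasurePreserving Neg.neg (volume.restrict (Set.Icc (-1 : ℝ) 1))
      (volume.restrict (Set.Icc (-1) 1)) := by
    simpa using (Measure.measurePreserving_neg (volume : Measure ℝ)).restrict_preimage
      (measurableSet_Icc (a := (-1 : ℝ)) (b := 1))
  refine measure_ext_of_Ioi_of_measurePreserving_neg
    ⟨measurable_neg, map_neg_map_fst_uniformSphere⟩ (hrestrict.smul_measure _) ?_ fun a ha => ?_
  · rw [measure_univ, Measure.smul_apply, Measure.restrict_apply_univ, Real.volume_Icc,
      sub_neg_eq_add, one_add_one_eq_two, ENNReal.ofReal_ofNat, smul_eq_mul,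
      ENNReal.inv_mul_cancel two_ne_zero ENNReal.ofNat_ne_top]
  · have hIoc : Set.Ioi a ∩ Set.Icc (-1) 1 = Set.Ioc a 1 := by
      ext t
      simp only [Set.mem_inter_iff, Set.mem_Ioi, Set.mem_Icc, Set.mem_Ioc]
      exact ⟨fun ht => ⟨ht.1, ht.2.2⟩, fun ht => ⟨ht.1, by linarith, ht.2⟩⟩
    rw [Measure.map_apply measurable_fst_coe_sphere measurableSet_Ioi, Measure.smul_apply,
      Measure.restrict_apply measurableSet_Ioi, hIoc, Real.volume_Ioc, smul_eq_mul]
    refine (uniformSphere_cap ha).trans ?_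
    rw [div_eq_inv_mul, ENNReal.ofReal_mul (by norm_num), ENNReal.ofReal_inv_of_pos two_pos,
      ENNReal.ofReal_ofNat]

theorem integral_comp_inner_uniformSphere {e : Bloch} (he : ‖e‖ = 1) {g : ℝ → ℝ}
    (hg : Measurable g) :
    ∫ n, g ⟪e, (n : Bloch)⟫ ∂uniformSphere Bloch = (∫ t in (-1 : ℝ)..1, g t) / 2 := by
  set north : Bloch := WithLp.toLp 2 (1, 0) with hnorth
  have hnorm : ‖north‖ = 1 := by
    rw [← sq_eq_sq₀ (norm_nonneg _) zero_le_one, Bloch.norm_sq_eq]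
    simp [hnorth]
  have hinner (x : Bloch) : ⟪north, x⟫ = x.fst := by
    simp [hnorth, WithLp.prod_inner_apply]
  obtain ⟨L, hL⟩ : ∃ L : Bloch ≃ₗᵢ[ℝ] Bloch, L north = e :=
    ⟨_, Submodule.reflection_sub (hnorm.trans he.symm)⟩
  rw [← integral_uniformSphere_comp_linearIsometryEquiv L fun x => g ⟪e, x⟫]
  simp only [← hL, LinearIsometryEquiv.inner_map_map, hinner]
  rw [← integral_map (φ := fun n : sphere (0 : Bloch) 1 => (n : Bloch).fst)
    measurable_fst_coe_sphere.aemeasurable hg.aestronglyMeasurable, map_fst_uniformSphere,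
    integral_smul_measure, intervalIntegral.integral_of_le (by norm_num),
    integral_Icc_eq_integral_Ioc, ENNReal.toReal_inv, ENNReal.toReal_ofNat, smul_eq_mul,
    inv_mul_eq_div]

end Archimedes

section CapResponse

open MeasureTheory Metric
open scoped RealInnerProductSpace

theorem integral_uniformSphere_comp_inner_smul {E : Type*} [NormedAddCommGroup E]
    [InnerProductSpace ℝ E] [MeasurableSpace E] [BorelSpace E] [FiniteDimensional ℝ E] {e : E}
    (he : ‖e‖ = 1) {g : ℝ → ℝ}
    (hg : Integrable (fun n : sphere (0 : E) 1 => g ⟪e, (n : E)⟫) (uniformSphere E)) :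
    ∫ n, g ⟪e, (n : E)⟫ • (n : E) ∂uniformSphere E =
      (∫ n, g ⟪e, (n : E)⟫ * ⟪e, (n : E)⟫ ∂uniformSphere E) • e := by
  have hint : Integrable (fun n : sphere (0 : E) 1 => g ⟪e, (n : E)⟫ • (n : E)) (uniformSphere E) :=
    integrable_smul_coe_sphere hg
  set I := ∫ n, g ⟪e, (n : E)⟫ • (n : E) ∂uniformSphere E with hI
  set L := (ℝ ∙ e).reflection
  have hLe : L e = e :=
    Submodule.reflection_mem_subspace_eq_self (Submodule.mem_span_singleton_self e)
  have hLI : L I = I := by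
    calc L I = ∫ n, L (g ⟪e, (n : E)⟫ • (n : E)) ∂uniformSphere E :=
          (L.toContinuousLinearEquiv.toContinuousLinearMap.integral_comp_comm hint).symm
      _ = ∫ n, g ⟪e, L n⟫ • L n ∂uniformSphere E := by
          refine integral_congr_ae (.of_forall fun n => ?_)
          have hinner : ⟪e, L n⟫ = ⟪e, (n : E)⟫ := by
            conv_lhs => rw [← hLe, L.inner_map_map]
          simp only [hinner, map_smul]
      _ = I := integral_uniformSphere_comp_linearIsometryEquiv L fun x => g ⟪e, x⟫ • x
  obtain ⟨c, hc⟩ := Submodule.mem_span_singleton.mp ((Submodule.reflection_eq_self_iff I).mp hLI)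
  have hinner : ∫ n, g ⟪e, (n : E)⟫ * ⟪e, (n : E)⟫ ∂uniformSphere E = ⟪e, I⟫ := by
    rw [hI, ← integral_inner hint]
    simp only [real_inner_smul_right]
  rw [hinner, ← hc, real_inner_smul_right, real_inner_self_eq_norm_sq, he, one_pow, mul_one]

theorem measurable_real_sign : Measurable Real.sign :=
  Measurable.ite measurableSet_Iio measurable_const
    (Measurable.ite measurableSet_Ioi measurable_const measurable_const)

theorem abs_real_sign_le_one (r : ℝ) : |Real.sign r| ≤ 1 := by
  rcases Real.sign_apply_eq r with h | h | h <;> simp [h]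

theorem intervalIntegrable_mul_sign_add {f : ℝ → ℝ} (hf : Continuous f) (h a b : ℝ) :
    IntervalIntegrable (fun t => f t * Real.sign (t + h)) volume a b :=
  intervalIntegrable_iff.mpr <| (intervalIntegrable_iff.mp (hf.intervalIntegrable a b)).mul_bdd
    (c := 1) (measurable_real_sign.comp (measurable_id.add_const h)).aestronglyMeasurable
    (.of_forall fun _ => abs_real_sign_le_one _)

theorem integral_mul_sign_add {a b h : ℝ} (ha : a ≤ -h) (hb : -h ≤ b) {f : ℝ → ℝ}
    (hf : Continuous f) :
    ∫ t in a..b, f t * Real.sign (t + h) = (∫ t in (-h)..b, f t) - ∫ t in a..(-h), f t := by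
  have hright : ∫ t in (-h)..b, f t * Real.sign (t + h) = ∫ t in (-h)..b, f t := by
    refine intervalIntegral.integral_congr_ae (.of_forall fun _ ht => ?_)
    rw [Set.uIoc_of_le hb] at ht
    rw [Real.sign_of_pos (by linarith [ht.1]), mul_one]
  have hleft : ∫ t in a..(-h), f t * Real.sign (t + h) = -∫ t in a..(-h), f t := by
    rw [← intervalIntegral.integral_neg]
    refine intervalIntegral.integral_congr_ae ?_
    filter_upwards [Measure.ae_ne volume (-h)] with t hth ht
    rw [Set.uIoc_of_le ha] at ht
    rw [Real.sign_of_neg (by linarith [lt_of_le_of_ne ht.2 hth]), mul_neg, mul_one]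
  rw [← intervalIntegral.integral_add_adjacent_intervals
      (intervalIntegrable_mul_sign_add hf h a (-h)) (intervalIntegrable_mul_sign_add hf h (-h) b),
    hright, hleft, neg_add_eq_sub]

/-- The step `η sign (t + h)`, shifted by a constant that makes its mean over `[-1, 1]` equal to
`h / 2` whatever the height `η`. -/
noncomputable def capProfile (η h t : ℝ) : ℝ := η * Real.sign (t + h) + (1 - 2 * η) * (h / 2)

theorem measurable_capProfile (η h : ℝ) : Measurable (capProfile η h) :=
  ((measurable_real_sign.comp (measurable_id.add_const h)).const_mul η).add_const _

theorem abs_capProfile_le {η h : ℝ} (hη0 : 0 ≤ η) (hη1 : η ≤ 1 / 2) (hh : |h| ≤ 1) (t : ℝ) :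
    |capProfile η h t| ≤ 1 / 2 :=
  calc |capProfile η h t| ≤ |η * Real.sign (t + h)| + |(1 - 2 * η) * (h / 2)| := abs_add_le _ _
    _ = η * |Real.sign (t + h)| + (1 - 2 * η) * (|h| / 2) := by
        rw [abs_mul, abs_mul, abs_of_nonneg hη0, abs_of_nonneg (by linarith : 0 ≤ 1 - 2 * η),
          abs_div, abs_two]
    _ ≤ η * 1 + (1 - 2 * η) * (1 / 2) := by
        have := abs_real_sign_le_one (t + h)
        gcongr
        linarith
    _ = 1 / 2 := by ring

theorem integral_mul_capProfile {h : ℝ} (hh : |h| ≤ 1) (η : ℝ) {f : ℝ → ℝ} (hf : Continuous f) :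
    ∫ t in (-1 : ℝ)..1, f t * capProfile η h t =
      η * ((∫ t in (-h)..1, f t) - ∫ t in (-1)..(-h), f t) +
        (1 - 2 * η) * (h / 2) * ∫ t in (-1)..1, f t := by
  have hsign := integral_mul_sign_add (neg_le_neg (abs_le.mp hh).2) (neg_le.mp (abs_le.mp hh).1) hf
  have hsplit (t : ℝ) : f t * capProfile η h t =
      η * (f t * Real.sign (t + h)) + (1 - 2 * η) * (h / 2) * f t := by
    rw [capProfile]
    ring
  simp only [hsplit]
  rw [intervalIntegral.integral_add ((intervalIntegrable_mul_sign_add hf h _ _).const_mul η)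
      ((hf.intervalIntegrable _ _).const_mul _),
    intervalIntegral.integral_const_mul, intervalIntegral.integral_const_mul, hsign]

/-- The deviation from `1 / 2` of the probability with which a party holding the hidden direction
`n` answers a question of Bloch vector `v` and bias `h`: the party looks whether `n` lies in the
spherical cap `⟪v, n⟫ + h ‖v‖ > 0`. -/
noncomputable def capResponse (v : Bloch) (h : ℝ) (n : Bloch) : ℝ :=
  capProfile (‖v‖ / (1 - h ^ 2)) h ⟪‖v‖⁻¹ • v, n⟫

theorem measurable_capResponse (v : Bloch) (h : ℝ) : Measurable (capResponse v h) :=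
  (measurable_capProfile _ h).comp (by fun_prop)

theorem capResponse_neg (v : Bloch) (h : ℝ) (n : Bloch) :
    capResponse (-v) (-h) n = -capResponse v h n := by
  simp only [capResponse, capProfile, norm_neg, neg_sq, smul_neg, inner_neg_left, ← neg_add,
    Real.sign_neg]
  ring

theorem capResponse_zero (n : Bloch) : capResponse 0 0 n = 0 := by
  simp [capResponse, capProfile]

theorem abs_capResponse_le {v : Bloch} {h : ℝ} (hvh : h ^ 2 + 2 * ‖v‖ ≤ 1) (n : Bloch) :
    |capResponse v h n| ≤ 1 / 2 := by
  have hv := norm_nonneg v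
  refine abs_capProfile_le (div_nonneg hv (by linarith)) ?_ ?_ _
  · exact div_le_of_le_mul₀ (by linarith) (by norm_num) (by linarith)
  · exact sq_le_one_iff_abs_le_one h |>.mp (by linarith)

theorem integrable_capResponse {v : Bloch} {h : ℝ} (hvh : h ^ 2 + 2 * ‖v‖ ≤ 1) :
    Integrable (fun n : sphere (0 : Bloch) 1 => capResponse v h n) (uniformSphere Bloch) :=
  .of_bound ((measurable_capResponse v h).comp measurable_subtype_coe).aestronglyMeasurable (1 / 2)
    (.of_forall fun n => abs_capResponse_le hvh n)

theorem exists_capResponse_eq_capProfile_inner (v : Bloch) (h : ℝ) :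
    ∃ e : Bloch, ‖e‖ = 1 ∧ v = ‖v‖ • e ∧
      capResponse v h = fun n => capProfile (‖v‖ / (1 - h ^ 2)) h ⟪e, n⟫ := by
  rcases eq_or_ne v 0 with rfl | hv
  · obtain ⟨e, he⟩ := exists_norm_eq Bloch zero_le_one
    refine ⟨e, he, by simp, funext fun n => ?_⟩
    simp [capResponse, capProfile]
  · exact ⟨‖v‖⁻¹ • v, norm_smul_inv_norm (𝕜 := ℝ) hv,
      (smul_inv_smul₀ (norm_ne_zero_iff.mpr hv) v).symm, rfl⟩

theorem integral_capResponse {v : Bloch} {h : ℝ} (hvh : h ^ 2 + 2 * ‖v‖ ≤ 1) :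
    ∫ n, capResponse v h n ∂uniformSphere Bloch = h / 2 := by
  have hh : |h| ≤ 1 := sq_le_one_iff_abs_le_one h |>.mp (by linarith [norm_nonneg v])
  obtain ⟨e, he, -, hcap⟩ := exists_capResponse_eq_capProfile_inner v h
  have hprofile := integral_mul_capProfile hh (‖v‖ / (1 - h ^ 2)) (f := fun _ => 1) continuous_const
  simp only [one_mul, intervalIntegral.integral_const, smul_eq_mul, mul_one] at hprofile
  rw [hcap, integral_comp_inner_uniformSphere he (measurable_capProfile _ h), hprofile]
  ring

theorem integral_capResponse_smul {v : Bloch} {h : ℝ} (hvh : h ^ 2 + 2 * ‖v‖ ≤ 1) :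
    ∫ n, capResponse v h n • (n : Bloch) ∂uniformSphere Bloch = (1 / 2 : ℝ) • v := by
  have hv := norm_nonneg v
  have hh : |h| ≤ 1 := sq_le_one_iff_abs_le_one h |>.mp (by linarith)
  have hheight : ‖v‖ / (1 - h ^ 2) * (1 - h ^ 2) = ‖v‖ :=
    div_mul_cancel_of_imp fun h0 => by linarith
  obtain ⟨e, he, hve, hcap⟩ := exists_capResponse_eq_capProfile_inner v h
  have hint : Integrable (fun n : sphere (0 : Bloch) 1 =>
      capProfile (‖v‖ / (1 - h ^ 2)) h ⟪e, (n : Bloch)⟫) (uniformSphere Bloch) := by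
    simpa only [hcap] using integrable_capResponse hvh
  have hprofile := integral_mul_capProfile hh (‖v‖ / (1 - h ^ 2)) continuous_id
  simp only [id_eq, integral_id] at hprofile
  rw [hcap, integral_uniformSphere_comp_inner_smul he hint,
    integral_comp_inner_uniformSphere he (g := fun t => capProfile _ h t * t)
      ((measurable_capProfile _ h).mul measurable_id)]
  simp only [mul_comm (capProfile _ h _)]
  rw [hprofile, hve, smul_smul]
  congr 1
  rw [← hve]
  linear_combination hheight / 2

end CapResponse

/-! ### Projective measurements on a qubit -/

section Projections

open scoped InnerProductSpace

theorem isIdempotentElem_fin_two_cases {K : Type*} [Field K] {P : Matrix (Fin 2) (Fin 2) K}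
    (hP : IsIdempotentElem P) : P = 0 ∨ P = 1 ∨ P.trace = 1 ∧ P.det = 0 := by
  have hcayley : (P.trace - 1) • P = P.det • (1 : Matrix (Fin 2) (Fin 2) K) := by
    have hchar := P.aeval_self_charpoly
    simp only [charpoly_fin_two, map_add, map_sub, map_mul, Polynomial.aeval_X,
      Polynomial.aeval_C, sq, hP.eq, Algebra.algebraMap_eq_smul_one, smul_mul_assoc,
      one_mul] at hchar
    rw [sub_smul, one_smul, ← sub_eq_zero, ← neg_eq_zero, ← hchar]
    abel
  rcases eq_or_ne P.trace 1 with htr | htr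
  · rw [htr, sub_self, zero_smul, eq_comm, smul_eq_zero] at hcayley
    exact .inr (.inr ⟨htr, hcayley.resolve_right one_ne_zero⟩)
  · obtain ⟨c, rfl⟩ : ∃ c : K, P = c • (1 : Matrix (Fin 2) (Fin 2) K) :=
      ⟨(P.trace - 1)⁻¹ * P.det, by
        rw [mul_smul, ← hcayley, inv_smul_smul₀ (sub_ne_zero.mpr htr)]⟩
    have hc : c * c = c := by simpa using congrFun₂ hP.eq 0 0
    rcases IsIdempotentElem.iff_eq_zero_or_one.mp hc with rfl | rfl
    · exact .inl (zero_smul _ _)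
    · exact .inr (.inl (one_smul _ _))

theorem add_eq_one_of_isIdempotentElem {K : Type*} [Field K] [CharZero K]
    {P Q : Matrix (Fin 2) (Fin 2) K} (hP : IsIdempotentElem P) (hQ : IsIdempotentElem Q)
    (hPQ : P * Q = 0) (hQP : Q * P = 0) (hP0 : P ≠ 0) (hQ0 : Q ≠ 0) : P + Q = 1 := by
  have hP1 : P ≠ 1 := fun h => hQ0 (by rwa [h, one_mul] at hPQ)
  have hQ1 : Q ≠ 1 := fun h => hP0 (by rwa [h, one_mul] at hQP)
  have htrP := ((isIdempotentElem_fin_two_cases hP).resolve_left hP0).resolve_left hP1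
  have htrQ := ((isIdempotentElem_fin_two_cases hQ).resolve_left hQ0).resolve_left hQ1
  have hsum : IsIdempotentElem (P + Q) := by
    rw [IsIdempotentElem, add_mul, mul_add, mul_add, hP.eq, hQ.eq, hPQ, hQP, add_zero, zero_add]
  have htr : (P + Q).trace = 2 := by rw [trace_add, htrP.1, htrQ.1, one_add_one_eq_two]
  rcases isIdempotentElem_fin_two_cases hsum with h | h | h
  · simp [h] at htr
  · exact h
  · norm_num [h.1] at htr

namespace ProjMeas

variable {k : ℕ} (M : ProjMeas k)

theorem isStarProjection (c : Fin k) : IsStarProjection (M.P c) := ⟨M.idem c, M.herm c⟩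

theorem sum_apply_eq_zero_of_odd {f : Matrix (Fin 2) (Fin 2) ℂ → ℝ} (hf0 : f 0 = 0)
    (hodd : ∀ P, f (1 - P) = -f P) : ∑ c, f (M.P c) = 0 := by
  by_cases hpair : ∃ c d, c ≠ d ∧ M.P c ≠ 0 ∧ M.P d ≠ 0
  · obtain ⟨c, d, hcd, hc, hd⟩ := hpair
    have hone : M.P c + M.P d = 1 := add_eq_one_of_isIdempotentElem (M.idem c) (M.idem d)
      (M.orth c d hcd) (M.orth d c hcd.symm) hc hd
    rw [Fintype.sum_eq_add c d hcd, ← sub_eq_of_eq_add' hone.symm, hodd, add_neg_cancel]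
    rintro e ⟨hec, hed⟩
    rw [← mul_one (M.P e), ← hone, mul_add, M.orth e c hec, M.orth e d hed, add_zero, hf0]
  · push Not at hpair
    obtain ⟨c, hc⟩ : ∃ c, M.P c ≠ 0 := by
      by_contra! hall
      simpa [hall] using M.sum_eq_one
    have hzero (d : Fin k) (hd : d ≠ c) : M.P d = 0 := hpair c d hd.symm hc
    have hone : M.P c = 1 := by
      rw [← M.sum_eq_one, Fintype.sum_eq_single c hzero]
    rw [Fintype.sum_eq_single c fun d hd => by rw [hzero d hd, hf0], hone, ← sub_zero 1, hodd,
      hf0, neg_zero]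

end ProjMeas

/-- The observable `n · σ`, where `(z, w) : Bloch` stands for the vector `(Re w, -Im w, z)`. -/
def pauli : Bloch →ₗ[ℝ] Matrix (Fin 2) (Fin 2) ℂ where
  toFun n := !![(n.fst : ℂ), n.snd; star n.snd, -n.fst]
  map_add' m n := by
    ext i j
    fin_cases i <;> fin_cases j <;> simp [add_comm]
  map_smul' c n := by
    ext i j
    fin_cases i <;> fin_cases j <;> simp

theorem pauli_mul_self (n : Bloch) : pauli n * pauli n = ((‖n‖ ^ 2 : ℝ) : ℂ) • 1 := by
  have hnorm : (‖n‖ ^ 2 : ℂ) = n.fst * n.fst + n.snd * star n.snd := by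
    rw [Complex.star_def, Complex.mul_conj, ← Complex.ofReal_pow, Bloch.norm_sq_eq,
      Complex.normSq_eq_norm_sq]
    push_cast
    ring
  ext i j
  fin_cases i <;> fin_cases j <;> simp [pauli, hnorm, mul_apply] <;> ring

theorem posSemidef_one_add_pauli {n : Bloch} (hn : ‖n‖ = 1) : (1 + pauli n).PosSemidef := by
  have hherm : (1 + pauli n).IsHermitian := by
    ext i j
    fin_cases i <;> fin_cases j <;> simp [pauli]
  have hsq : (1 + pauli n)ᴴ * (1 + pauli n) = (2 : ℂ) • (1 + pauli n) := by
    rw [hherm.eq, mul_add, mul_one, add_mul, one_mul, pauli_mul_self, hn, one_pow,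
      Complex.ofReal_one]
    module
  have hhalf : 1 + pauli n = (1 / 2 : ℂ) • ((1 + pauli n)ᴴ * (1 + pauli n)) := by
    rw [hsq, smul_smul]
    norm_num
  rw [hhalf]
  exact (posSemidef_conjTranspose_mul_self _).smul one_half_pos.le

/-- The Bloch vector `m` of the transpose of a Hermitian operator: `2 Pᵀ = tr P + m · σ`. It is the
transpose that matters below, since an outcome `P` on one half of `|ψ_θ⟩` steers the other half
to a state proportional to `√ρ Pᵀ √ρ`. -/
def blochVec : Matrix (Fin 2) (Fin 2) ℂ →ₗ[ℝ] Bloch where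
  toFun P := WithLp.toLp 2 ((P 0 0 - P 1 1).re, 2 * P 1 0)
  map_add' P Q := congrArg (WithLp.toLp 2) <| Prod.ext
    (by simp only [Matrix.add_apply, Complex.sub_re, Complex.add_re]; exact add_sub_add_comm ..)
    (mul_add 2 (P 1 0) (Q 1 0))
  map_smul' c P := congrArg (WithLp.toLp 2) <| Prod.ext
    (by simp [mul_sub]) (by simp [mul_left_comm])

theorem blochVec_one : blochVec 1 = 0 := by
  simp [blochVec]

theorem norm_blochVec_sq {P : Matrix (Fin 2) (Fin 2) ℂ} (hP : P.IsHermitian) :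
    ‖blochVec P‖ ^ 2 = P.trace.re ^ 2 - 4 * P.det.re := by
  have him (i : Fin 2) : (P i i).im = 0 := Complex.conj_eq_iff_im.mp (hP.apply i i)
  rw [Bloch.norm_sq_eq, det_fin_two, trace_fin_two, ← hP.apply 0 1, Complex.star_def,
    mul_comm (starRingEnd ℂ _), Complex.mul_conj, Complex.normSq_eq_norm_sq]
  simp only [blochVec, LinearMap.coe_mk, AddHom.coe_mk, WithLp.toLp_fst, WithLp.toLp_snd, norm_mul,
    Complex.norm_ofNat, mul_pow, Complex.sub_re, Complex.add_re, Complex.mul_re, him,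
    Complex.ofReal_re]
  ring

theorem norm_blochVec_eq_one {P : Matrix (Fin 2) (Fin 2) ℂ} (hP : P.IsHermitian)
    (htr : P.trace = 1) (hdet : P.det = 0) : ‖blochVec P‖ = 1 := by
  have hsq := norm_blochVec_sq hP
  rw [htr, hdet, Complex.one_re, Complex.zero_re, mul_zero, sub_zero, one_pow] at hsq
  exact (pow_eq_one_iff_of_nonneg (norm_nonneg _) two_ne_zero).mp hsq

end Projections

/-! ### Unsteerable two-qubit states -/

section Steering

open MeasureTheory Metric
open scoped InnerProductSpace

/-- The criterion of Bowles, Hirsch, Quintino and Brunner on a two-qubit state in canonical form,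
with Bloch vector `a` on the measured side and correlation matrix `T`. -/
def BowlesCondition (a : Bloch) (T : Bloch →ₗ[ℝ] Bloch) : Prop :=
  ∀ m : Bloch, ‖m‖ = 1 → ⟪a, m⟫_ℝ ^ 2 + 2 * ‖T m‖ ≤ 1

variable {a : Bloch} {T : Bloch →ₗ[ℝ] Bloch} {P : Matrix (Fin 2) (Fin 2) ℂ}

/-- The probability that the local hidden state model for `(a, T)` answers a measurement with the
outcome `P` when the hidden state has Bloch vector `n`. -/
noncomputable def blochResponse (a : Bloch) (T : Bloch →ₗ[ℝ] Bloch)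
    (P : Matrix (Fin 2) (Fin 2) ℂ) (n : Bloch) : ℝ :=
  P.trace.re / 2 + capResponse (T (blochVec P)) ⟪a, blochVec P⟫_ℝ n

theorem measurable_blochResponse (a : Bloch) (T : Bloch →ₗ[ℝ] Bloch)
    (P : Matrix (Fin 2) (Fin 2) ℂ) : Measurable (blochResponse a T P) :=
  (measurable_capResponse _ _).const_add _

theorem sum_blochResponse (a : Bloch) (T : Bloch →ₗ[ℝ] Bloch) {k : ℕ} (M : ProjMeas k)
    (n : Bloch) : ∑ c, blochResponse a T (M.P c) n = 1 := by
  have htrace : ∑ c, (M.P c).trace.re / 2 = 1 := by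
    rw [← Finset.sum_div, ← Complex.re_sum, ← trace_sum, M.sum_eq_one]
    simp
  simp only [blochResponse]
  rw [Finset.sum_add_distrib, htrace, M.sum_apply_eq_zero_of_odd
    (f := fun P => capResponse (T (blochVec P)) ⟪a, blochVec P⟫_ℝ n), add_zero]
  · simp only [map_zero, inner_zero_right, capResponse_zero]
  · intro P
    simp only [map_sub, blochVec_one, zero_sub, map_neg, inner_neg_right, capResponse_neg]

theorem BowlesCondition.apply_blochVec_le (h : BowlesCondition a T) (hP : IsStarProjection P) :
    ⟪a, blochVec P⟫_ℝ ^ 2 + 2 * ‖T (blochVec P)‖ ≤ 1 := by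
  rcases isIdempotentElem_fin_two_cases hP.isIdempotentElem with rfl | rfl | ⟨htr, hdet⟩
  · simp
  · simp [blochVec_one]
  · exact h _ (norm_blochVec_eq_one hP.isSelfAdjoint htr hdet)

theorem blochResponse_nonneg (h : BowlesCondition a T) (hP : IsStarProjection P) (n : Bloch) :
    0 ≤ blochResponse a T P n := by
  have hcap := abs_capResponse_le (h.apply_blochVec_le hP) n
  rw [blochResponse]
  rcases isIdempotentElem_fin_two_cases hP.isIdempotentElem with rfl | rfl | ⟨htr, -⟩
  · simp [capResponse_zero]
  · simp [blochVec_one, capResponse_zero]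
  · rw [htr, Complex.one_re]
    linarith [neg_abs_le (capResponse (T (blochVec P)) ⟪a, blochVec P⟫_ℝ n)]

theorem integrable_blochResponse (h : BowlesCondition a T) (hP : IsStarProjection P) :
    Integrable (fun n : sphere (0 : Bloch) 1 => blochResponse a T P n) (uniformSphere Bloch) :=
  (integrable_const _).add (integrable_capResponse (h.apply_blochVec_le hP))

theorem integral_blochResponse (h : BowlesCondition a T) (hP : IsStarProjection P) :
    ∫ n, blochResponse a T P n ∂uniformSphere Bloch =
      (P.trace.re + ⟪a, blochVec P⟫_ℝ) / 2 := by
  simp only [blochResponse]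
  rw [integral_add (integrable_const _) (integrable_capResponse (h.apply_blochVec_le hP)),
    integral_const, probReal_univ, one_smul, integral_capResponse (h.apply_blochVec_le hP), add_div]

theorem integral_blochResponse_smul (h : BowlesCondition a T) (hP : IsStarProjection P) :
    ∫ n, blochResponse a T P n • (n : Bloch) ∂uniformSphere Bloch =
      (1 / 2 : ℝ) • T (blochVec P) := by
  simp only [blochResponse, add_smul]
  rw [integral_add (integrable_smul_coe_sphere (integrable_const _))
      (integrable_smul_coe_sphere (integrable_capResponse (h.apply_blochVec_le hP))),
    integral_smul, integral_coe_uniformSphere, smul_zero, zero_add,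
    integral_capResponse_smul (h.apply_blochVec_le hP)]

theorem integral_blochResponse_smul_add {F : Type*} [NormedAddCommGroup F] [NormedSpace ℝ F]
    [CompleteSpace F] (h : BowlesCondition a T) (hP : IsStarProjection P) (c : F)
    (g : Bloch →ₗ[ℝ] F) :
    ∫ n, blochResponse a T P n • (c + g n) ∂uniformSphere Bloch =
      (1 / 2 : ℝ) • ((P.trace.re + ⟪a, blochVec P⟫_ℝ) • c + g (T (blochVec P))) := by
  have hint := integrable_smul_coe_sphere (integrable_blochResponse h hP)
  have hg := g.toContinuousLinearMap.integral_comp_comm hint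
  have hg' := g.toContinuousLinearMap.integrable_comp hint
  simp only [LinearMap.coe_toContinuousLinearMap', map_smul] at hg hg'
  simp only [smul_add]
  rw [integral_add ((integrable_blochResponse h hP).smul_const c) hg', integral_smul_const,
    integral_blochResponse h hP, hg, integral_blochResponse_smul h hP, map_smul]
  module

/-- The unnormalized state of the second qubit after the outcome `P` on the first one. -/
def assemblage (ρ : Matrix (Fin 2 × Fin 2) (Fin 2 × Fin 2) ℂ) (P : Matrix (Fin 2) (Fin 2) ℂ) :
    Matrix (Fin 2) (Fin 2) ℂ :=
  of fun u v => (bBlock ρ u v * P).trace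

/-- Two-qubit states that projective measurements on the first qubit cannot steer: the assemblages
of all these measurements come from one local hidden state model, with response functions `r` and
hidden states `τ`. The hidden states are unnormalized, their weights being absorbed in `τ`. -/
def IsUnsteerable (ρ : Matrix (Fin 2 × Fin 2) (Fin 2 × Fin 2) ℂ) : Prop :=
  ∃ (Λ : Type) (_ : MeasurableSpace Λ) (μ : Measure Λ) (_ : IsProbabilityMeasure μ)
    (r : (k : ℕ) → ProjMeas k → Fin k → Λ → ℝ) (τ : Λ → Matrix (Fin 2) (Fin 2) ℂ),
    (∀ k M c, Measurable (r k M c)) ∧ (∀ k M c l, 0 ≤ r k M c l) ∧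
    (∀ k M l, ∑ c, r k M c l = 1) ∧
    (∀ l, (τ l).PosSemidef) ∧ (∀ u v, Integrable (fun l => τ l u v) μ) ∧
    ∀ k (M : ProjMeas k) c u v, assemblage ρ (M.P c) u v = ∫ l, r k M c l • τ l u v ∂μ

theorem BowlesCondition.isUnsteerable {ρ : Matrix (Fin 2 × Fin 2) (Fin 2 × Fin 2) ℂ}
    (h : BowlesCondition a T) (D : Matrix (Fin 2) (Fin 2) ℂ)
    (hρ : ∀ P, IsStarProjection P → assemblage ρ P =
      D * ((1 / 2 : ℝ) • ((P.trace.re + ⟪a, blochVec P⟫_ℝ) • 1 + pauli (T (blochVec P)))) * Dᴴ) :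
    IsUnsteerable ρ := by
  let entry (u v : Fin 2) : Matrix (Fin 2) (Fin 2) ℂ →ₗ[ℝ] ℂ :=
    entryLinearMap ℝ ℂ u v ∘ₗ LinearMap.mulRight ℝ Dᴴ ∘ₗ LinearMap.mulLeft ℝ D
  refine ⟨sphere (0 : Bloch) 1, inferInstance, uniformSphere Bloch, inferInstance,
    fun k M c n => blochResponse a T (M.P c) n, fun n => D * (1 + pauli n) * Dᴴ,
    fun k M c => (measurable_blochResponse a T _).comp measurable_subtype_coe,
    fun k M c n => blochResponse_nonneg h (M.isStarProjection c) n,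
    fun k M n => sum_blochResponse a T M n,
    fun n => (posSemidef_one_add_pauli (mem_sphere_zero_iff_norm.mp n.2)).mul_mul_conjTranspose_same
      D, fun u v => ?_, fun k M c u v => ?_⟩
  · have hpauli := (entry u v ∘ₗ pauli).toContinuousLinearMap.integrable_comp
      (integrable_smul_coe_sphere (integrable_const (μ := uniformSphere Bloch) (1 : ℝ)))
    simp only [one_smul] at hpauli
    exact ((integrable_const (entry u v 1)).add hpauli).congr
      (.of_forall fun n => (map_add (entry u v) _ _).symm)
  · have hmodel := integral_blochResponse_smul_add h (M.isStarProjection c) (entry u v 1)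
      (entry u v ∘ₗ pauli)
    rw [hρ _ (M.isStarProjection c)]
    simp only [LinearMap.comp_apply, ← map_add, ← map_smul] at hmodel
    exact hmodel.symm.trans (integral_congr_ae (.of_forall fun n => map_smul (entry u v) _ _))

end Steering

section UnsteerableRhoTwo

open scoped InnerProductSpace

/-- The linear map `diag (tx, tx, tz)` on Bloch vectors, with `tz` along the axis of the first
coordinate. -/
noncomputable def axialMap (tz tx : ℝ) : Bloch →ₗ[ℝ] Bloch where
  toFun n := WithLp.toLp 2 (tz * n.fst, tx • n.snd)
  map_add' _ _ := congrArg (WithLp.toLp 2) <| Prod.ext (mul_add ..) (smul_add ..)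
  map_smul' _ _ := congrArg (WithLp.toLp 2) <| Prod.ext (mul_left_comm ..) (smul_comm ..)

theorem inner_toLp_zero (a : ℝ) (m : Bloch) :
    ⟪(WithLp.toLp 2 (a, 0) : Bloch), m⟫_ℝ = a * m.fst := by
  simp [WithLp.prod_inner_apply, mul_comm]

theorem bowlesCondition_axialMap {a tz tx : ℝ} (htz : 0 ≤ tz) (hpole : a ^ 2 + 2 * tz ≤ 1)
    (hslope : tx ^ 2 - tz ^ 2 ≤ a ^ 2 * tz) :
    BowlesCondition (WithLp.toLp 2 (a, 0)) (axialMap tz tx) := by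
  intro m hm
  have hm' : ‖m.snd‖ ^ 2 = 1 - m.fst ^ 2 := by rw [← one_pow 2, ← hm, Bloch.norm_sq_eq]; ring
  have hfst : 0 ≤ 1 - m.fst ^ 2 := hm' ▸ sq_nonneg _
  have hnorm : ‖axialMap tz tx m‖ ^ 2 = tz ^ 2 * m.fst ^ 2 + tx ^ 2 * (1 - m.fst ^ 2) := by
    rw [Bloch.norm_sq_eq, ← hm']
    simp [axialMap, mul_pow]
  have hle : ‖axialMap tz tx m‖ ≤ tz + a ^ 2 * (1 - m.fst ^ 2) / 2 := by
    refine abs_le_of_sq_le_sq' ?_ (by positivity) |>.2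
    rw [hnorm]
    nlinarith [mul_le_mul_of_nonneg_right hslope hfst, sq_nonneg (a ^ 2 * (1 - m.fst ^ 2))]
  rw [inner_toLp_zero]
  linarith

theorem assemblage_rhoTwo (α θ : ℝ) (P : Matrix (Fin 2) (Fin 2) ℂ) :
    assemblage (rhoTwo α θ) P =
      !![((Real.cos θ ^ 2 * ((1 + α) / 2) : ℝ) : ℂ) * P 0 0 +
          ((Real.sin θ ^ 2 * ((1 - α) / 2) : ℝ) : ℂ) * P 1 1,
        ((α * (Real.cos θ * Real.sin θ) : ℝ) : ℂ) * P 1 0;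
        ((α * (Real.cos θ * Real.sin θ) : ℝ) : ℂ) * P 0 1,
        ((Real.cos θ ^ 2 * ((1 - α) / 2) : ℝ) : ℂ) * P 0 0 +
          ((Real.sin θ ^ 2 * ((1 + α) / 2) : ℝ) : ℂ) * P 1 1] := by
  ext u v
  fin_cases u <;> fin_cases v
  · simp [assemblage, bBlock_rhoTwo_zero_zero, trace_fin_two, diagonal_mul]
  · simp [assemblage, bBlock_rhoTwo_of_ne, trace_fin_two, mul_apply]
  · simp [assemblage, bBlock_rhoTwo_of_ne, trace_fin_two, mul_apply]
  · simp [assemblage, bBlock_rhoTwo_one_one, trace_fin_two, diagonal_mul]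

theorem assemblage_rhoTwo_eq_conj {α θ a tz tx s₀ s₁ : ℝ}
    (hs₀ : s₀ ^ 2 = (1 + α * Real.cos (2 * θ)) / 2)
    (hs₁ : s₁ ^ 2 = (1 - α * Real.cos (2 * θ)) / 2)
    (h₀ : s₀ ^ 2 * (a + tz) = (Real.cos (2 * θ) + α) / 2)
    (h₁ : s₁ ^ 2 * (a - tz) = (Real.cos (2 * θ) - α) / 2)
    (hx : s₀ * s₁ * tx = α * Real.sin (2 * θ) / 2)
    {P : Matrix (Fin 2) (Fin 2) ℂ} (hP : P.IsHermitian) :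
    assemblage (rhoTwo α θ) P = diagonal ![(s₀ : ℂ), s₁] *
      ((1 / 2 : ℝ) • ((P.trace.re + ⟪WithLp.toLp 2 (a, 0), blochVec P⟫_ℝ) • 1 +
        pauli (axialMap tz tx (blochVec P)))) * (diagonal ![(s₀ : ℂ), s₁])ᴴ := by
  obtain ⟨p, hp⟩ : ∃ p : ℝ, P 0 0 = p :=
    ⟨(P 0 0).re, (Complex.conj_eq_iff_re.mp (hP.apply 0 0)).symm⟩
  obtain ⟨q, hq⟩ : ∃ q : ℝ, P 1 1 = q :=
    ⟨(P 1 1).re, (Complex.conj_eq_iff_re.mp (hP.apply 1 1)).symm⟩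
  have hcs : α * (Real.cos θ * Real.sin θ) = s₀ * s₁ * tx := by rw [hx, Real.sin_two_mul]; ring
  have hsin := Real.sin_sq θ
  rw [Real.cos_two_mul] at hs₀ hs₁ h₀ h₁
  have hdiag₀ : Real.cos θ ^ 2 * ((1 + α) / 2) * p + Real.sin θ ^ 2 * ((1 - α) / 2) * q =
      s₀ ^ 2 * ((p + q + (a + tz) * (p - q)) / 2) := by
    linear_combination (1 - α) / 2 * q * hsin - (p + q) / 2 * hs₀ - (p - q) / 2 * h₀
  have hdiag₁ : Real.cos θ ^ 2 * ((1 - α) / 2) * p + Real.sin θ ^ 2 * ((1 + α) / 2) * q =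
      s₁ ^ 2 * ((p + q + (a - tz) * (p - q)) / 2) := by
    linear_combination (1 + α) / 2 * q * hsin - (p + q) / 2 * hs₁ - (p - q) / 2 * h₁
  rw [assemblage_rhoTwo, inner_toLp_zero, trace_fin_two, hcs, hp, hq, ← hP.apply 0 1]
  ext u v
  rw [diagonal_conjTranspose, mul_diagonal, diagonal_mul]
  fin_cases u <;> fin_cases v <;>
    simp only [Fin.zero_eta, Fin.mk_one, of_apply, cons_val', cons_val_zero, cons_val_one,
      cons_val_fin_one, Pi.star_apply, RCLike.star_def, Complex.conj_ofReal, Matrix.smul_apply,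
      Matrix.add_apply, one_apply_eq, one_apply_ne, ne_eq, zero_ne_one, one_ne_zero,
      not_false_eq_true, Complex.real_smul, smul_zero, pauli, blochVec, axialMap, LinearMap.coe_mk,
      AddHom.coe_mk, WithLp.toLp_fst, WithLp.toLp_snd, Complex.sub_re, Complex.add_re, hp, hq,
      Complex.ofReal_re, map_mul, map_ofNat]
  · linear_combination (norm := (push_cast; ring)) congrArg Complex.ofReal hdiag₀
  · push_cast
    ring
  · push_cast
    ring
  · linear_combination (norm := (push_cast; ring)) congrArg Complex.ofReal hdiag₁

section Parameters

variable {α C S : ℝ}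

theorem mul_one_sub_sq_le (hα0 : 0 < α) (hα1 : α ≤ 1)
    (h : 2 * α - 1 ≤ C ^ 2 * ((2 - α) * α ^ 3)) :
    α * (1 - α ^ 2 * C ^ 2) ≤ 1 - α ^ 2 := by
  have hsub : 0 ≤ (2 - α) * (1 - α ^ 2 - α * (1 - α ^ 2 * C ^ 2)) := by
    linear_combination h + mul_nonneg (sq_nonneg (1 - α)) (by linarith : 0 ≤ 1 + α)
  linarith [nonneg_of_mul_nonneg_right hsub (by linarith : 0 < 2 - α)]

theorem exists_bowles_parameters_of_pos (hα0 : 0 < α) (hα1 : α ≤ 1) (hCS : S ^ 2 = 1 - C ^ 2)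
    (h : 2 * α - 1 ≤ C ^ 2 * ((2 - α) * α ^ 3)) (hpos : 0 < 1 - α ^ 2 * C ^ 2) :
    ∃ a tz tx : ℝ, 0 ≤ tz ∧ a ^ 2 + 2 * tz ≤ 1 ∧ tx ^ 2 - tz ^ 2 ≤ a ^ 2 * tz ∧
      (1 + α * C) * (a + tz) = C + α ∧ (1 - α * C) * (a - tz) = C - α ∧
      √(1 - α ^ 2 * C ^ 2) * tx = α * S := by
  have hD := mul_one_sub_sq_le hα0 hα1 h
  set D := 1 - α ^ 2 * C ^ 2 with hDdef
  have hsqrt : √D ^ 2 = D := Real.sq_sqrt hpos.le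
  refine ⟨C * (1 - α ^ 2) / D, α * S ^ 2 / D, α * S / √D, by positivity, ?_, ?_, ?_, ?_,
    mul_div_cancel₀ _ (Real.sqrt_pos.mpr hpos).ne'⟩
  · have hgap : 1 - ((C * (1 - α ^ 2) / D) ^ 2 + 2 * (α * S ^ 2 / D)) =
        S ^ 2 * (C ^ 2 * ((2 - α) * α ^ 3) - (2 * α - 1)) / D ^ 2 := by
      field_simp
      rw [hCS, hDdef]
      ring
    exact sub_nonneg.mp (hgap ▸ div_nonneg (mul_nonneg (sq_nonneg S) (sub_nonneg.mpr h))
      (sq_nonneg D))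
  · have hgap : (C * (1 - α ^ 2) / D) ^ 2 * (α * S ^ 2 / D) -
        ((α * S / √D) ^ 2 - (α * S ^ 2 / D) ^ 2) =
        α * S ^ 2 * C ^ 2 * (1 - α ^ 2) * (1 - α ^ 2 - α * D) / D ^ 3 := by
      rw [div_pow (α * S), hsqrt]
      field_simp
      rw [hCS, hDdef]
      ring
    have hα2 : α ^ 2 ≤ 1 := pow_le_one₀ hα0.le hα1
    refine sub_nonneg.mp (hgap ▸ div_nonneg (mul_nonneg (mul_nonneg ?_ ?_) ?_) ?_)
    · positivity
    · linarith
    · linarith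
    · positivity
  · field_simp
    rw [hCS, hDdef]
    ring
  · field_simp
    rw [hCS, hDdef]
    ring

theorem exists_bowles_parameters (hα0 : 0 < α) (hα1 : α ≤ 1) (hCS : S ^ 2 = 1 - C ^ 2)
    (h : steerBound α ≤ C ^ 2) :
    ∃ a tz tx : ℝ, 0 ≤ tz ∧ a ^ 2 + 2 * tz ≤ 1 ∧ tx ^ 2 - tz ^ 2 ≤ a ^ 2 * tz ∧
      (1 + α * C) * (a + tz) = C + α ∧ (1 - α * C) * (a - tz) = C - α ∧
      √(1 - α ^ 2 * C ^ 2) * tx = α * S := by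
  have hα2 : 0 < 2 - α := by linarith
  rw [steerBound, div_le_iff₀ (by positivity)] at h
  have hC : C ^ 2 ≤ 1 := by linarith [sq_nonneg S]
  have hα : α ^ 2 ≤ 1 := pow_le_one₀ hα0.le hα1
  rcases (sub_nonneg.mpr (mul_le_one₀ hα (sq_nonneg C) hC)).eq_or_lt with hzero | hpos
  · have hC1 : C ^ 2 = 1 := by nlinarith
    have hα1 : α = 1 := by nlinarith
    have hS : S = 0 := by simpa [hC1] using hCS
    subst hα1 hS
    exact ⟨C, 0, 0, le_rfl, by linarith, by simp, by linear_combination hC1,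
      by linear_combination -hC1, by simp⟩
  · exact exists_bowles_parameters_of_pos hα0 hα1 hCS h hpos

end Parameters

theorem isUnsteerable_rhoTwo {α θ : ℝ} (hα0 : 0 < α) (hα1 : α ≤ 1)
    (h : steerBound α ≤ Real.cos (2 * θ) ^ 2) : IsUnsteerable (rhoTwo α θ) := by
  obtain ⟨a, tz, tx, htz, hpole, hslope, h₀, h₁, hx⟩ :=
    exists_bowles_parameters hα0 hα1 (Real.sin_sq (2 * θ)) h
  have hcos : |α * Real.cos (2 * θ)| ≤ 1 := by
    rw [abs_mul, abs_of_pos hα0]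
    exact mul_le_one₀ hα1 (abs_nonneg _) (Real.abs_cos_le_one _)
  have hb₀ : 0 ≤ (1 + α * Real.cos (2 * θ)) / 2 := by linarith [neg_le_of_abs_le hcos]
  have hb₁ : 0 ≤ (1 - α * Real.cos (2 * θ)) / 2 := by linarith [le_of_abs_le hcos]
  have hprod : √((1 + α * Real.cos (2 * θ)) / 2) * √((1 - α * Real.cos (2 * θ)) / 2) =
      √(1 - α ^ 2 * Real.cos (2 * θ) ^ 2) / 2 := by
    rw [← Real.sqrt_mul hb₀, ← Real.sqrt_sq zero_le_two, ← Real.sqrt_div' _ (sq_nonneg 2),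
      Real.sqrt_sq zero_le_two]
    congr 1
    ring
  refine (bowlesCondition_axialMap htz hpole hslope).isUnsteerable _ fun P hP =>
    assemblage_rhoTwo_eq_conj (Real.sq_sqrt hb₀) (Real.sq_sqrt hb₁) ?_ ?_ ?_ hP.isSelfAdjoint
  · rw [Real.sq_sqrt hb₀]
    linear_combination h₀ / 2
  · rw [Real.sq_sqrt hb₁]
    linear_combination h₁ / 2
  · rw [hprod]
    linear_combination hx / 2

end UnsteerableRhoTwo

/-! ### Local models after filtering -/

section Filter

open MeasureTheory

variable {N : ℕ} {Λ : Type} [MeasurableSpace Λ]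

/-- The measurement with a single outcome. Its statistics normalize a local model. -/
def ProjMeas.trivial : ProjMeas 1 where
  P _ := 1
  herm _ := isHermitian_one
  idem _ := mul_one 1
  orth a b hab := absurd (Subsingleton.elim a b) hab
  sum_eq_one := Fintype.sum_unique _

theorem localTensor_one : localTensor (fun _ : Fin N => (1 : Matrix (Fin 2) (Fin 2) ℂ)) = 1 := by
  simpa using localTensor_diagonal fun (_ : Fin N) (_ : Fin 2) => 1

theorem hasFullyLocalModel_inv_trace_smul {X : QubitOp N} {ν : Measure Λ} {W : Λ → ℝ}
    {r : Fin N → (k : ℕ) → ProjMeas k → Fin k → Λ → ℝ} (hX : X.trace ≠ 0)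
    (hW : Integrable W ν) (hW0 : ∀ l, 0 ≤ W l) (hr : ∀ i k M a, Measurable (r i k M a))
    (hr0 : ∀ i k M a l, 0 ≤ r i k M a l) (hr1 : ∀ i k M l, ∑ a, r i k M a l = 1)
    (hmodel : ∀ (k : Fin N → ℕ) (M : ∀ i, ProjMeas (k i)) (a : ∀ i, Fin (k i)),
      (X * localTensor fun i => (M i).P (a i)).trace =
        ((∫ l, W l * ∏ i, r i (k i) (M i) (a i) l ∂ν : ℝ) : ℂ)) :
    HasFullyLocalModel (X.trace⁻¹ • X) := by
  have htrivial (i l) : r i 1 ProjMeas.trivial 0 l = 1 := by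
    simpa using hr1 i 1 ProjMeas.trivial l
  have htrace : X.trace = ((∫ l, W l ∂ν : ℝ) : ℂ) := calc
    X.trace = (X * localTensor fun _ => 1).trace := by rw [localTensor_one, mul_one]
    _ = ((∫ l, W l * ∏ i, r i 1 ProjMeas.trivial 0 l ∂ν : ℝ) : ℂ) :=
      hmodel (fun _ => 1) (fun _ => ProjMeas.trivial) fun _ => 0
    _ = ((∫ l, W l ∂ν : ℝ) : ℂ) := by simp only [htrivial, Finset.prod_const_one, mul_one]
  have hpos : 0 < ∫ l, W l ∂ν :=
    (integral_nonneg hW0).lt_of_ne' fun h => hX (by rw [htrace, h, Complex.ofReal_zero])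
  have hdens (l : Λ) : 0 ≤ (∫ l, W l ∂ν)⁻¹ * W l := mul_nonneg (inv_nonneg.mpr hpos.le) (hW0 l)
  have hint := hW.const_mul (∫ l, W l ∂ν)⁻¹
  refine ⟨Λ, inferInstance, ν.withDensity fun l => ENNReal.ofReal ((∫ l, W l ∂ν)⁻¹ * W l), ⟨?_⟩,
    r, hr, hr0, hr1, fun k M a => ?_⟩
  · rw [withDensity_apply _ .univ, Measure.restrict_univ,
      ← ofReal_integral_eq_lintegral_ofReal hint (.of_forall hdens), integral_const_mul,
      inv_mul_cancel₀ hpos.ne', ENNReal.ofReal_one]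
  · rw [integral_withDensity_eq_integral_toReal_smul₀ hint.aemeasurable.ennreal_ofReal
      (.of_forall fun l => ENNReal.ofReal_lt_top)]
    simp only [ENNReal.toReal_ofReal (hdens _), smul_eq_mul, mul_assoc, integral_const_mul]
    rw [smul_mul, trace_smul, hmodel, htrace, smul_eq_mul, Complex.ofReal_mul, Complex.ofReal_inv]

theorem sum_sum_prod_nonneg {ι d : Type*} [Fintype ι] [Fintype d] {τ : ι → Matrix d d ℂ}
    (hτ : ∀ i, (τ i).PosSemidef) : 0 ≤ ∑ u, ∑ v, ∏ i, τ i u v := by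
  simpa [dotProduct, mulVec] using
    (posSemidef_prod_submatrix hτ (fun _ => id) Finset.univ).dotProduct_mulVec_nonneg (1 : d → ℂ)

theorem trace_sum_localTensor_bBlock_mul (ρ : Matrix (Fin 2 × Fin 2) (Fin 2 × Fin 2) ℂ)
    (P : Fin N → Matrix (Fin 2) (Fin 2) ℂ) :
    ((∑ u, ∑ v, localTensor fun _ => bBlock ρ u v) * localTensor P).trace =
      ∑ u, ∑ v, ∏ i, assemblage ρ (P i) u v := by
  simp only [Finset.sum_mul, trace_sum, localTensor_mul, trace_localTensor, assemblage, of_apply]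

section Integral

variable {ι d : Type*} [Fintype ι] [Fintype d] {μ : Measure Λ} [SigmaFinite μ]
  {f : ι → Λ → Matrix d d ℂ}

theorem integrable_sum_sum_prod (hf : ∀ i u v, Integrable (fun l => f i l u v) μ) :
    Integrable (fun l : ι → Λ => ∑ u, ∑ v, ∏ i, f i (l i) u v) (.pi fun _ => μ) :=
  integrable_finsetSum _ fun u _ => integrable_finsetSum _ fun v _ =>
    .fintype_prod fun i => hf i u v

theorem integral_sum_sum_prod (hf : ∀ i u v, Integrable (fun l => f i l u v) μ) :
    ∫ l : ι → Λ, ∑ u, ∑ v, ∏ i, f i (l i) u v ∂.pi (fun _ => μ) =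
      ∑ u, ∑ v, ∏ i, ∫ l, f i l u v ∂μ := by
  have hprod (u v : d) : Integrable (fun l : ι → Λ => ∏ i, f i (l i) u v) (.pi fun _ => μ) :=
    .fintype_prod fun i => hf i u v
  rw [integral_finsetSum _ fun u _ => integrable_finsetSum _ fun v _ => hprod u v]
  refine Finset.sum_congr rfl fun u _ => ?_
  rw [integral_finsetSum _ fun v _ => hprod u v]
  exact Finset.sum_congr rfl fun v _ => integral_fintype_prod_eq_prod fun i l => f i l u v

end Integral

theorem IsUnsteerable.hasFullyLocalModel {ρ : Matrix (Fin 2 × Fin 2) (Fin 2 × Fin 2) ℂ}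
    (hρ : IsUnsteerable ρ) {S : QubitOp N} (hS : S = ∑ u, ∑ v, localTensor fun _ => bBlock ρ u v)
    (hS0 : S.trace ≠ 0) : HasFullyLocalModel (S.trace⁻¹ • S) := by
  obtain ⟨Λ, _, μ, _, r, τ, hr, hr0, hr1, hτ, hτint, hmodel⟩ := hρ
  have hW (l : Fin N → Λ) : 0 ≤ ∑ u, ∑ v, ∏ i, τ (l i) u v := sum_sum_prod_nonneg fun i => hτ (l i)
  have hr_le (k M c l) : ‖r k M c l‖ ≤ 1 := by
    rw [Real.norm_of_nonneg (hr0 k M c l), ← hr1 k M l]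
    exact Finset.single_le_sum (fun c _ => hr0 k M c l) (Finset.mem_univ c)
  have hrτ (k M c u v) : Integrable (fun l => (r k M c l • τ l) u v) μ :=
    (hτint u v).bdd_smul 1 (hr k M c).aestronglyMeasurable (.of_forall (hr_le k M c))
  refine hasFullyLocalModel_inv_trace_smul
    (ν := .pi fun _ => μ) (W := fun l : Fin N → Λ => (∑ u, ∑ v, ∏ i, τ (l i) u v).re)
    (r := fun i k M c l => r k M c (l i)) hS0
    (integrable_sum_sum_prod fun _ => hτint).re
    (fun l => (Complex.nonneg_iff.mp (hW l)).1)
    (fun i k M c => (hr k M c).comp (measurable_pi_apply i)) (fun i k M c l => hr0 k M c (l i))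
    (fun i k M l => hr1 k M (l i)) fun k M c => ?_
  have hfactor (l : Fin N → Λ) :
      (((∑ u, ∑ v, ∏ i, τ (l i) u v).re * ∏ i, r (k i) (M i) (c i) (l i) : ℝ) : ℂ) =
        ∑ u, ∑ v, ∏ i, (r (k i) (M i) (c i) (l i) • τ (l i)) u v := by
    rw [Complex.ofReal_mul, ← Complex.eq_re_of_ofReal_le (r := 0) (by simpa using hW l)]
    simp only [Matrix.smul_apply, Complex.real_smul, Finset.prod_mul_distrib, ← Finset.mul_sum,
      Complex.ofReal_prod]
    exact mul_comm _ _
  rw [hS, trace_sum_localTensor_bBlock_mul, ← integral_complex_ofReal]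
  simp only [hmodel, hfactor]
  exact (integral_sum_sum_prod fun i => hrτ (k i) (M i) (c i)).symm

theorem hasFullyLocalModel_rhoA [NeZero N] {α θ : ℝ} (hα0 : 0 < α) (hα1 : α ≤ 1)
    (h : steerBound α ≤ Real.cos (2 * θ) ^ 2) : HasFullyLocalModel (rhoA N α θ) := by
  rw [rhoA, ← trace_traceB]
  refine (isUnsteerable_rhoTwo hα0 hα1 h).hasFullyLocalModel (traceB_filtered N α θ) ?_
  rw [trace_traceB, trace_filtered]
  exact_mod_cast (successProb_pos N hα0.le hα1 θ).ne'

end Filter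

section Parameter

variable {N : ℕ} {α θ : ℝ}

theorem mem_Ico_of_eq_one_sub_one_div_sq (hN : 2 ≤ N) (hα : α = 1 - 1 / (N : ℝ) ^ 2) :
    α ∈ Set.Ico (1 / 2) 1 := by
  have hN' : (2 : ℝ) ≤ N := by exact_mod_cast hN
  have hpos : 0 < 1 / (N : ℝ) ^ 2 := by positivity
  have hle : 1 / (N : ℝ) ^ 2 ≤ 1 / 2 := one_div_le_one_div_of_le two_pos (by nlinarith)
  constructor <;> linarith

/- Bernoulli's inequality gives `α ^ N ≥ 1 - 1 / N` and `((1 + α) / 2) ^ N ≥ 1 - 1 / (2 N)`. -/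
theorem one_lt_sum_pow (hN : 2 ≤ N) (hα : α = 1 - 1 / (N : ℝ) ^ 2) :
    1 < α ^ N + ((1 + α) / 2) ^ N + ((1 - α) / 2) ^ N := by
  obtain ⟨hα0, hα1⟩ := mem_Ico_of_eq_one_sub_one_div_sq hN hα
  have hN' : (2 : ℝ) ≤ N := by exact_mod_cast hN
  have hN_mul : (N : ℝ) * (α - 1) = -(1 / N) := by
    rw [hα]
    field_simp
    ring
  have hinv : 1 / (N : ℝ) ≤ 1 / 2 := one_div_le_one_div_of_le two_pos hN'
  have hα_pow := one_add_mul_le_pow (show -2 ≤ α - 1 by linarith) N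
  have hmid_pow := one_add_mul_le_pow (show -2 ≤ (α - 1) / 2 by linarith) N
  rw [add_sub_cancel] at hα_pow
  rw [show 1 + (α - 1) / 2 = (1 + α) / 2 by ring] at hmid_pow
  have hrest : 0 < ((1 - α) / 2) ^ N := pow_pos (by linarith) N
  linarith

theorem steerBound_mem_Ico (h0 : 1 / 2 ≤ α) (h1 : α < 1) : steerBound α ∈ Set.Ico 0 1 := by
  have hpos : 0 < (2 - α) * α ^ 3 := mul_pos (by linarith) (by positivity)
  refine ⟨div_nonneg (by linarith) hpos.le, (div_lt_one hpos).mpr ?_⟩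
  have hgap : 0 < (1 - α) ^ 3 * (1 + α) := mul_pos (pow_pos (by linarith) 3) (by linarith)
  linear_combination hgap

theorem exists_cos_two_mul_sq_eq {x : ℝ} (hx : x ∈ Set.Ico 0 1) :
    ∃ θ, 0 < θ ∧ θ ≤ Real.pi / 4 ∧ Real.cos (2 * θ) ^ 2 = x := by
  have hsqrt : √x < 1 := (Real.sqrt_lt' one_pos).mpr (by simpa using hx.2)
  refine ⟨Real.arccos √x / 2, half_pos (Real.arccos_pos.mpr hsqrt), ?_, ?_⟩
  · linarith [Real.arccos_le_pi_div_two.mpr (Real.sqrt_nonneg x)]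
  · rw [mul_div_cancel₀ _ two_ne_zero,
      Real.cos_arccos (by linarith [Real.sqrt_nonneg x]) hsqrt.le, Real.sq_sqrt hx.1]

theorem concurrence_rhoA_pos [NeZero N] (hα0 : 0 ≤ α) (hα1 : α ≤ 1)
    (hθ : 0 < Real.sin (2 * θ)) (h : 1 < α ^ N + ((1 + α) / 2) ^ N + ((1 - α) / 2) ^ N) :
    0 < concurrence (rhoA N α θ) := by
  have hZ := successProb_pos N hα0 hα1 θ
  rw [concurrence_rhoA hα0 hα1 hθ.le, ← two_pow_mul_successProb]
  exact div_pos (mul_pos (by positivity) (sub_pos.mpr h)) (by positivity)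

end Parameter

theorem mainTheorem1 (N : ℕ) (hN : 2 ≤ N) :
    (∀ α θ : ℝ, 0 ≤ α → α ≤ 1 → 0 ≤ θ → θ ≤ Real.pi / 4 →
      IsDensity (rhoA N α θ) ∧
      concurrence (rhoA N α θ) =
        2 * Real.sin (2 * θ) ^ N *
            (α ^ N + ((1 + α) / 2) ^ N + ((1 - α) / 2) ^ N - 1) /
          ((1 + α * Real.cos (2 * θ)) ^ N + (1 - α * Real.cos (2 * θ)) ^ N) ∧
      (0 < concurrence (rhoA N α θ) → IsGME (rhoA N α θ)) ∧
      (0 < α → steerBound α ≤ Real.cos (2 * θ) ^ 2 → HasFullyLocalModel (rhoA N α θ))) ∧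
    (∀ α : ℝ, α = 1 - 1 / (N : ℝ) ^ 2 →
      1 < α ^ N + ((1 + α) / 2) ^ N + ((1 - α) / 2) ^ N ∧
      (∃ θ : ℝ, 0 < θ ∧ θ ≤ Real.pi / 4 ∧ Real.cos (2 * θ) ^ 2 = steerBound α) ∧
      ∀ θ : ℝ, 0 < θ → θ ≤ Real.pi / 4 → Real.cos (2 * θ) ^ 2 = steerBound α →
        0 < concurrence (rhoA N α θ) ∧ IsGME (rhoA N α θ) ∧
          HasFullyLocalModel (rhoA N α θ)) := by
  have : NeZero N := ⟨by omega⟩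
  constructor
  · intro α θ hα0 hα1 hθ0 hθ1
    have hsin : 0 ≤ Real.sin (2 * θ) :=
      Real.sin_nonneg_of_nonneg_of_le_pi (by linarith) (by linarith)
    have hρ := isDensity_rhoA N hα0 hα1 θ
    exact ⟨hρ, concurrence_rhoA hα0 hα1 hsin, hρ.isGME_of_concurrence_pos,
      fun hα h => hasFullyLocalModel_rhoA hα hα1 h⟩
  · intro α hα
    obtain ⟨hα0, hα1⟩ := mem_Ico_of_eq_one_sub_one_div_sq hN hα
    have hα_pos : 0 < α := by linarith
    have hsum := one_lt_sum_pow hN hα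
    refine ⟨hsum, exists_cos_two_mul_sq_eq (steerBound_mem_Ico hα0 hα1), fun θ hθ0 hθ1 hθ => ?_⟩
    have hsin : 0 < Real.sin (2 * θ) := Real.sin_pos_of_pos_of_lt_pi (by linarith) (by linarith)
    have hC := concurrence_rhoA_pos hα_pos.le hα1.le hsin hsum
    exact ⟨hC, (isDensity_rhoA N hα_pos.le hα1.le θ).isGME_of_concurrence_pos hC,
      hasFullyLocalModel_rhoA hα_pos hα1.le hθ.ge⟩
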